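/- All Banach spaces and scalars are real. A sequence $(x_i)_{i\in\mathbb N}$ in a Banach space is *normalized* if $\|x_i\|=1$ for all $i$, and *weakly null* if $f(x_i)\to 0$ for every bounded linear functional $f$. Let $c_{00}$ be the space of finitely supported real sequences, and write $\operatorname{supp}\mathbf a=\{i: a_i\neq 0\}$ for $\mathbf a=(a_i)\in c_{00}$. For $\delta\in(0,1]$ and a normalized, weakly null sequence $(x_i)$ define, with values in $[-\infty,\infty]$ and $\inf\emptyset=\infty$, $$K((x_i),\delta),\quad K'((x_i),\delta),\quad L((x_i),\delta),\quad L'((x_i),\delta)$$ to be the infimum of all real $C$ such that $$\Big\|\sum_{i\in E}a_ix_i\Big\|\le C\,\Big\|\sum_{i}a_ix_i\Big\|$$ holds for all $\mathbf a=(a_i)\in c_{00}$ and all finite $E\subset\mathbb N$ satisfying, respectively, * for $K$: $|a_i|\ge\delta$ for all $i\in E$, and $\sup_i|a_i|\le 1$; * for $K'$: $|a_i|\ge\delta$ for all $i\in E$, and $\|\sum_i a_ix_i\|\le 1$; * for $L$: $|a_i|\ge\delta$ for all $i\in\operatorname{supp}\mathbf a$, and $\sup_i|a_i|\le 1$ ($E$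 an arbitrary finite set); * for $L'$: $|a_i|\ge\delta$ for all $i\in\operatorname{supp}\mathbf a$, and $\|\sum_i a_ix_i\|\le 1$ ($E$ an arbitrary finite set). Put $$K(\delta)=\sup_{(x_i)}\ \inf_{(y_i)\subset(x_i)}K((y_i),\delta),$$ where the supremum is over all normalized, weakly null sequences $(x_i)$ in all Banach spaces and the infimum is over all subsequences $(y_i)$ of $(x_i)$; define $K'(\delta)$, $L(\delta)$ and $L'(\delta)$ in the same way. **Theorem.** For each $\delta\in(0,1]$, $$K(\delta)=\sup_{\alpha,(x_i)}\ \inf_{(y_i)\subset(x_i)}K((y_i),\delta),$$ where the supremum is over all countable successor ordinals $\alpha$ and all normalized, weakly null sequences $(x_i)$ in $C(\alpha)$, the space of real continuous functions on $\alpha$ (with its order topology) under the supremum norm, and the infimum is over all subsequences $(y_i)$ of $(x_i)$. The analogous equalities hold for $K'(\delta)$, $L(\delta)$ and $L'(\delta)$. -/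

import Mathlib

open Filter Topology

universe u

/-! ### The four constants of a sequence

Scalars are real. A finitely supported sequence is an element of `ℕ →₀ ℝ`. All constants take
values in `EReal`, so that the infimum of the empty set is `⊤`. -/

section SequenceConstants

variable {X : Type u} [NormedAddCommGroup X] [NormedSpace ℝ X]

/-- A normalized, weakly null sequence. -/
structure IsNormalizedWeaklyNull (x : ℕ → X) : Prop where
  norm_eq_one : ∀ i, ‖x i‖ = 1
  weakly_null : ∀ f : X →L[ℝ] ℝ, Tendsto (fun i => f (x i)) atTop (𝓝 0)

/-- `K((x_i), δ)`: large coefficients are projected, normalization `sup |a_i| ≤ 1`.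
(For `δ > 0` every `E ⊆ {i : |a_i| ≥ δ}` is finite, as `a` is finitely supported.) -/
noncomputable def seqK (δ : ℝ) (x : ℕ → X) : EReal :=
  ⨅ (C : ℝ) (_ : ∀ (a : ℕ →₀ ℝ) (E : Finset ℕ),
      (∀ i ∈ E, δ ≤ |a i|) → (∀ i, |a i| ≤ 1) →
        ‖∑ i ∈ E, a i • x i‖ ≤ C * ‖∑ i ∈ a.support, a i • x i‖), (C : EReal)

/-- `K'((x_i), δ)`: large coefficients are projected, normalization `‖∑ a_i x_i‖ ≤ 1`. -/
noncomputable def seqKPrime (δ : ℝ) (x : ℕ → X) : EReal :=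
  ⨅ (C : ℝ) (_ : ∀ (a : ℕ →₀ ℝ) (E : Finset ℕ),
      (∀ i ∈ E, δ ≤ |a i|) → ‖∑ i ∈ a.support, a i • x i‖ ≤ 1 →
        ‖∑ i ∈ E, a i • x i‖ ≤ C * ‖∑ i ∈ a.support, a i • x i‖), (C : EReal)

/-- `L((x_i), δ)`: all non-zero coefficients are large, normalization `sup |a_i| ≤ 1`. -/
noncomputable def seqL (δ : ℝ) (x : ℕ → X) : EReal :=
  ⨅ (C : ℝ) (_ : ∀ (a : ℕ →₀ ℝ) (E : Finset ℕ),
      (∀ i ∈ a.support, δ ≤ |a i|) → (∀ i, |a i| ≤ 1) →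
        ‖∑ i ∈ E, a i • x i‖ ≤ C * ‖∑ i ∈ a.support, a i • x i‖), (C : EReal)

/-- `L'((x_i), δ)`: all non-zero coefficients are large, normalization `‖∑ a_i x_i‖ ≤ 1`. -/
noncomputable def seqLPrime (δ : ℝ) (x : ℕ → X) : EReal :=
  ⨅ (C : ℝ) (_ : ∀ (a : ℕ →₀ ℝ) (E : Finset ℕ),
      (∀ i ∈ a.support, δ ≤ |a i|) → ‖∑ i ∈ a.support, a i • x i‖ ≤ 1 →
        ‖∑ i ∈ E, a i • x i‖ ≤ C * ‖∑ i ∈ a.support, a i • x i‖), (C : EReal)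

/-- Supremum over all normalized, weakly null sequences `(x_i)` in `X` of the infimum of
`F (y_i)` over all subsequences `(y_i)` of `(x_i)`. -/
noncomputable def supInfSubseq (F : (ℕ → X) → EReal) : EReal :=
  ⨆ (x : ℕ → X) (_ : IsNormalizedWeaklyNull x),
    ⨅ (φ : ℕ → ℕ) (_ : StrictMono φ), F (x ∘ φ)

end SequenceConstants

/-! ### The constants `K(δ)`, `K'(δ)`, `L(δ)`, `L'(δ)`: suprema over all Banach spaces -/

noncomputable def constK (δ : ℝ) : EReal :=
  ⨆ (X : Type u) (_ : NormedAddCommGroup X) (_ : NormedSpace ℝ X) (_ : CompleteSpace X),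
    supInfSubseq (X := X) (seqK δ)

noncomputable def constKPrime (δ : ℝ) : EReal :=
  ⨆ (X : Type u) (_ : NormedAddCommGroup X) (_ : NormedSpace ℝ X) (_ : CompleteSpace X),
    supInfSubseq (X := X) (seqKPrime δ)

noncomputable def constL (δ : ℝ) : EReal :=
  ⨆ (X : Type u) (_ : NormedAddCommGroup X) (_ : NormedSpace ℝ X) (_ : CompleteSpace X),
    supInfSubseq (X := X) (seqL δ)

noncomputable def constLPrime (δ : ℝ) : EReal :=
  ⨆ (X : Type u) (_ : NormedAddCommGroup X) (_ : NormedSpace ℝ X) (_ : CompleteSpace X),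
    supInfSubseq (X := X) (seqLPrime δ)

/-! ### Countable successor ordinals as compact spaces -/

/-- The countable successor ordinals. -/
def CountableSuccOrdinal : Type (u + 1) :=
  {α : Ordinal.{u} // α.card ≤ Cardinal.aleph0 ∧ ∃ β : Ordinal.{u}, α = Order.succ β}

namespace CountableSuccOrdinal

/-- The well-ordered set of ordinals below `α`, to be given its order topology. -/
def Space (α : CountableSuccOrdinal.{u}) : Type u := α.1.ToType

noncomputable instance (α : CountableSuccOrdinal.{u}) : LinearOrder α.Space :=
  inferInstanceAs (LinearOrder α.1.ToType)

instance (α : CountableSuccOrdinal.{u}) : WellFoundedLT α.Space :=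
  inferInstanceAs (WellFoundedLT α.1.ToType)

noncomputable instance (α : CountableSuccOrdinal.{u}) : TopologicalSpace α.Space :=
  Preorder.topology α.Space

instance (α : CountableSuccOrdinal.{u}) : OrderTopology α.Space := ⟨rfl⟩

theorem exists_top (α : CountableSuccOrdinal.{u}) : ∃ t : α.Space, ∀ s : α.Space, s ≤ t := by
  obtain ⟨α, hc, β, rfl⟩ := α
  refine ⟨(Ordinal.ToType.mk ⟨β, Order.lt_succ β⟩ : (Order.succ β).ToType), fun s => ?_⟩
  obtain ⟨⟨γ, hγ⟩, rfl⟩ := (Ordinal.ToType.mk (o := Order.succ β)).surjective s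
  exact (Ordinal.ToType.mk (o := Order.succ β)).monotone
    (Subtype.mk_le_mk.mpr (Order.lt_succ_iff.mp (Set.mem_Iio.mp hγ)))

instance (α : CountableSuccOrdinal.{u}) : CompactSpace α.Space := by
  obtain ⟨t, ht⟩ := α.exists_top
  have : Nonempty α.Space := ⟨t⟩
  let _ : OrderBot α.Space := WellFoundedLT.toOrderBot α.Space
  let _ : ConditionallyCompleteLinearOrderBot α.Space :=
    WellFoundedLT.conditionallyCompleteLinearOrderBot α.Space
  refine ⟨?_⟩
  have h : (Set.univ : Set α.Space) = Set.Icc ⊥ t := by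
    ext s
    simp [ht s]
  rw [h]
  exact isCompact_Icc

end CountableSuccOrdinal

/-! Each `C(α)` is a Banach space, so only one inequality needs work. Let (x_i) be normalized and
weakly null, suppose that every subsequence violates the projection inequality with constant C', and
let 0 ≤ C < C'. It suffices to find a normalized weakly null sequence in some `C(α)` all of whose
subsequences violate it with constant C (`exists_continuousMap_violates`).

Let S be the family of finite sets A that carry a violating pair (a, E) together with a functional c
A of norm at most one detecting the large projection. Every infinite set contains a member of S, so
the finite sets outside S form a well-founded tree under inclusion. Backward induction along this
tree extends c to all finite sets by iterated ultrafilter limits in the compact set of dual values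
(`exists_iterated_limit`). Along a suitable subsequence φ these limits are attained up to
geometrically small errors, so the m-th value at F may be replaced by the value at F ∩ [0, m]
(`abs_sub_initial_le`).

The perturbed functionals are then a continuous image of a tree of finite sets in its Kleene–Brouwer
order, which is a countable well-order with greatest element ∅. After division by 1 + 8η they stay
below the original norm, because an almost biorthogonal system bounds coefficients (`abs_coeff_le`).
A further convergent sequence of norming functionals keeps the new sequence normalized. Evaluation
on this index set gives functions on a countable successor ordinal; they are pointwise null, hence
weakly null (`tendsto_apply_of_pointwise_null`). The range of any subsequence has an initial segment
in the tree that carries a witness, and this witness still violates the inequality with constant C.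
-/

/-! ### Subsequences and iterated ultrafilter limits. -/

/-- A subsequence whose `k`-th term is chosen, generically for the filter `l`, after its
predecessors. -/
theorem exists_strictMono_forall {l : Filter ℕ} [l.NeBot] (hl : l ≤ atTop)
    {P : ℕ → Finset ℕ → ℕ → Prop} (hP : ∀ k s, ∀ᶠ n in l, P k s n) :
    ∃ φ : ℕ → ℕ, StrictMono φ ∧ ∀ k, P k ((Finset.range k).image φ) (φ k) := by
  have hex : ∀ k (s : Finset ℕ), ∃ n, (∀ i ∈ s, i < n) ∧ P k s n := fun k s => by
    have h1 : ∀ᶠ n in l, ∀ i ∈ s, i < n :=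
      hl ((Finset.eventually_all s).2 fun i _ => eventually_gt_atTop i)
    exact (h1.and (hP k s)).exists
  choose m hm hmP using hex
  let S : ℕ → Finset ℕ := fun k => Nat.rec ∅ (fun k s => insert (m k s) s) k
  have hS : ∀ k, S (k + 1) = insert (m k (S k)) (S k) := fun k => rfl
  have hSφ : ∀ k, S k = (Finset.range k).image fun k => m k (S k) := by
    intro k
    induction k with
    | zero => rfl
    | succ k ih => rw [hS, Finset.range_add_one, Finset.image_insert, ← ih]
  refine ⟨fun k => m k (S k), strictMono_nat_of_lt_succ fun k => ?_, fun k => ?_⟩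
  · exact hm (k + 1) (S (k + 1)) _ (by rw [hS]; exact Finset.mem_insert_self _ _)
  · rw [← hSφ]; exact hmP _ _

/-- Backward induction along an ultrafilter: a choice of points of a compact set at the members
of a hereditary family of finite sets that meets every infinite set is extended to all finite
sets by iterated limits. -/
theorem exists_iterated_limit {Y : Type*} [TopologicalSpace Y] {D : Set Y} (hD : IsCompact D)
    {S : Set (Finset ℕ)} (hS : ∀ N : Set ℕ, N.Infinite → ∃ A ∈ S, (A : Set ℕ) ⊆ N)
    (hup : ∀ A ∈ S, ∀ B, A ⊆ B → B ∈ S) {c : Finset ℕ → Y} (hc : ∀ A ∈ S, c A ∈ D) :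
    ∃ f : Finset ℕ → Y, (∀ F, f F ∈ D) ∧ (∀ A ∈ S, f A = c A) ∧
      ∀ F ∉ S, Tendsto (fun n => f (insert n F)) (hyperfilter ℕ) (𝓝 (f F)) := by
  classical
  -- The recursion runs from larger sets to smaller ones. A strictly increasing chain outside S has
  -- infinite union, which contains some A in S; being finite, A lies in one term of the chain,
  -- which is then in S by heredity.
  let r : Finset ℕ → Finset ℕ → Prop := fun G F => F ∉ S ∧ F ⊂ G
  have wf : WellFounded r := by
    rw [wellFounded_iff_isEmpty_descending_chain]
    refine ⟨fun ⟨F, hF⟩ => ?_⟩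
    have hmono : StrictMono F := strictMono_nat_of_lt_succ fun n => (hF n).2
    have hinf : (⋃ n, (F n : Set ℕ)).Infinite := by
      intro hfin
      have hcard : ∀ n, n ≤ (F n).card := by
        intro n
        induction n with
        | zero => exact Nat.zero_le _
        | succ n ih => exact lt_of_le_of_lt ih (Finset.card_lt_card (hF n).2)
      have h1 : F (hfin.toFinset.card + 1) ⊆ hfin.toFinset := by
        intro x hx
        rw [Set.Finite.mem_toFinset]
        exact Set.mem_iUnion.2 ⟨_, hx⟩
      have := (hcard (hfin.toFinset.card + 1)).trans (Finset.card_le_card h1)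
      omega
    obtain ⟨A, hA, hAN⟩ := hS _ hinf
    obtain ⟨n, hn⟩ : ∃ n, A ⊆ F n := by
      have := DirectedOn.exists_mem_subset_of_finset_subset_biUnion (s := A) (f := fun n => (F n : Set ℕ))
        (c := Set.univ) ⟨0, trivial⟩ ?_ ?_
      · obtain ⟨n, -, hn⟩ := this
        exact ⟨n, by exact_mod_cast hn⟩
      · exact fun a _ b _ => ⟨max a b, trivial, hmono.monotone (le_max_left _ _),
          hmono.monotone (le_max_right _ _)⟩
      · simpa using hAN
    exact (hF n).1 (hup A hA _ hn)
  obtain ⟨A₀, hA₀, -⟩ := hS _ Set.infinite_univ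
  -- Filler value for n ∈ F; the hyperfilter does not see these finitely many n.
  let d := c A₀
  let step : ∀ F : Finset ℕ, (∀ G, r G F → Y) → Y := fun F rec =>
    if hF : F ∈ S then c F else
      if h : ∃ y ∈ D, Tendsto (fun n => if hn : n ∉ F then
          rec (insert n F) ⟨hF, Finset.ssubset_insert hn⟩ else d) (hyperfilter ℕ) (𝓝 y)
      then h.choose else d
  let f := wf.fix step
  have hf : ∀ F, f F = step F fun G _ => f G := fun F => wf.fix_eq step F
  have hnot : ∀ F : Finset ℕ, ∀ᶠ n in (hyperfilter ℕ : Filter ℕ), n ∉ F := fun F =>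
    Nat.hyperfilter_le_atTop
      ((eventually_gt_atTop (F.sup id)).mono fun n hn h =>
        absurd (Finset.le_sup (f := id) h) (not_le.2 hn))
  have main : ∀ F, f F ∈ D ∧
      (F ∉ S → Tendsto (fun n => f (insert n F)) (hyperfilter ℕ) (𝓝 (f F))) := by
    intro F
    induction F using wf.induction with
    | _ F ih =>
      by_cases hF : F ∈ S
      · refine ⟨?_, fun h => absurd hF h⟩
        rw [hf]; simp only [step, dif_pos hF]; exact hc F hF
      · set k : ℕ → Y := fun n => if hn : n ∉ F then f (insert n F) else d with hk
        have hkD : ∀ n, k n ∈ D := by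
          intro n
          by_cases hn : n ∉ F
          · simp only [hk, dif_pos hn]
            exact (ih _ ⟨hF, Finset.ssubset_insert hn⟩).1
          · simp only [hk, dif_neg hn]; exact hc _ hA₀
        have hlim : ∃ y ∈ D, Tendsto k (hyperfilter ℕ) (𝓝 y) := by
          obtain ⟨y, hy, hle⟩ := hD.ultrafilter_le_nhds ((hyperfilter ℕ).map k)
            (by
            rw [le_principal_iff, Ultrafilter.coe_map, Filter.mem_map]
            exact Filter.univ_mem' hkD)
          exact ⟨y, hy, hle⟩
        have hfF : f F = hlim.choose := by
          rw [hf]; simp only [step, dif_neg hF]; exact dif_pos hlim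
        rw [hfF]
        refine ⟨hlim.choose_spec.1, fun _ => hlim.choose_spec.2.congr' ?_⟩
        filter_upwards [hnot F] with n hn
        simp only [hk, dif_pos hn]
  refine ⟨f, fun F => (main F).1, fun A hA => ?_, fun F hF => (main F).2 hF⟩
  rw [hf]; simp only [step, dif_pos hA]

/-! ### The Kleene–Brouwer order on a tree of finite sets. -/

/-- A family of finite sets of natural numbers, to be given the Kleene–Brouwer order. -/
def KleeneBrouwer (T : Set (Finset ℕ)) : Type := {F : Finset ℕ // F ∈ T}

namespace KleeneBrouwer

variable {T : Set (Finset ℕ)}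

/-- The code of a finite set; sets are compared at their first difference. -/
def code (F : KleeneBrouwer T) : Lex (ℕ → Bool) := toLex fun n => decide (n ∉ F.1)

theorem code_injective : Function.Injective (code (T := T)) := by
  intro F G h
  refine Subtype.ext (Finset.ext fun n => ?_)
  have := congrFun (congrArg ofLex h) n
  simpa [code] using this

noncomputable instance : LinearOrder (KleeneBrouwer T) := LinearOrder.lift' code code_injective

instance : Countable (KleeneBrouwer T) := inferInstanceAs (Countable {F : Finset ℕ // F ∈ T})

theorem lt_iff {F G : KleeneBrouwer T} :
    F < G ↔ ∃ m, m ∈ F.1 ∧ m ∉ G.1 ∧ ∀ j < m, (j ∈ F.1 ↔ j ∈ G.1) := by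
  change (∃ i, (∀ j, j < i → code F j = code G j) ∧ code F i < code G i) ↔ _
  refine exists_congr fun m => ?_
  simp only [code, Pi.toLex_apply, Bool.lt_iff, decide_eq_false_iff_not, decide_eq_true_eq, not_not,
    decide_eq_decide, not_iff_not]
  tauto

theorem le_of_eq_empty (F G : KleeneBrouwer T) (hG : G.1 = ∅) : F ≤ G := by
  refine not_lt.1 fun h => ?_
  obtain ⟨m, hm, -⟩ := lt_iff.1 h
  simp [hG] at hm

/-- A descending chain has a pointwise ultrafilter limit N. If N is infinite, some term agrees with
N too far. If N is finite, a term that agrees with N up to its maximum but differs from N has a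
first extra element m; later terms lose m and so come after it in the order, against descent. Hence
two terms equal N, which is absurd. -/
theorem wellFounded
    (hT : ∀ N : Set ℕ, N.Infinite → ∃ n, ∀ F ∈ T, ∃ j < n, ¬(j ∈ F ↔ j ∈ N)) :
    WellFoundedLT (KleeneBrouwer T) := by
  refine ⟨wellFounded_iff_isEmpty_descending_chain.2 ⟨fun ⟨F, hF⟩ => ?_⟩⟩
  have hanti : StrictAnti F := strictAnti_nat_of_succ_lt hF
  let N : Set ℕ := {n | ∀ᶠ k in (hyperfilter ℕ : Filter ℕ), n ∈ (F k).1}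
  have hN : ∀ m, ∀ᶠ k in (hyperfilter ℕ : Filter ℕ), ∀ j < m, (j ∈ (F k).1 ↔ j ∈ N) := by
    intro m
    have : ∀ᶠ k in (hyperfilter ℕ : Filter ℕ), ∀ j ∈ Finset.range m, (j ∈ (F k).1 ↔ j ∈ N) := by
      rw [Finset.eventually_all]
      intro j _
      by_cases hj : j ∈ N
      · filter_upwards [hj] with k hk
        exact iff_of_true hk hj
      · filter_upwards [Ultrafilter.eventually_not.2 hj] with k hk
        exact iff_of_false hk hj
    simpa using this
  have hfin : N.Finite := by
    by_contra hinf
    obtain ⟨n, hn⟩ := hT N hinf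
    obtain ⟨k, hk⟩ := (hN n).exists
    obtain ⟨j, hj, hne⟩ := hn _ (F k).2
    exact hne (hk j hj)
  have key : ∀ᶠ k in (hyperfilter ℕ : Filter ℕ), ∀ j, j ∈ (F k).1 ↔ j ∈ N := by
    obtain ⟨b, hb⟩ := hfin.bddAbove
    filter_upwards [hN (b + 1)] with k hk
    by_contra hne
    push Not at hne
    obtain ⟨j, hj⟩ := hne
    have hex : ∃ j, j ∈ (F k).1 ∧ j ∉ N := by
      rcases hj with ⟨h1, h2⟩ | ⟨h1, h2⟩
      · exact ⟨j, h1, h2⟩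
      · exact absurd ((hk j (Nat.lt_succ_of_le (hb h2))).2 h2) h1
    classical
    let m := Nat.find hex
    obtain ⟨hm1, hm2⟩ := Nat.find_spec hex
    have hagree : ∀ j < m, (j ∈ (F k).1 ↔ j ∈ N) := by
      intro j hj
      refine ⟨fun h => by_contra fun h' => Nat.find_min hex hj ⟨h, h'⟩, fun h => ?_⟩
      exact (hk j (Nat.lt_succ_of_le (hb h))).2 h
    obtain ⟨k', hk', hkk'⟩ := ((hN (m + 1)).and
      (Nat.hyperfilter_le_atTop (eventually_gt_atTop k))).exists
    refine lt_asymm (hanti hkk') (lt_iff.2 ⟨m, hm1, fun h => hm2 ((hk' m m.lt_succ_self).1 h), ?_⟩)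
    exact fun j hj => (hagree j hj).trans (hk' j (hj.trans m.lt_succ_self)).symm
  obtain ⟨k, hk⟩ := key.exists
  obtain ⟨k', hk', hkk'⟩ := (key.and
    (Nat.hyperfilter_le_atTop (eventually_gt_atTop k))).exists
  refine (hanti hkk').ne (Subtype.ext (Finset.ext fun j => ?_))
  rw [hk, hk']

/-- In a tree, sets just below `F` in the Kleene–Brouwer order agree with `F` on an initial
segment. -/
theorem exists_lt_forall_agree (hT : ∀ F ∈ T, ∀ n, F.filter (· < n) ∈ T) (F : KleeneBrouwer T)
    (n : ℕ) : (∀ v, F ≤ v) ∨ ∃ u < F, ∀ v, u < v → v ≤ F → ∀ j < n, (j ∈ v.1 ↔ j ∈ F.1) := by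
  by_cases hbot : ∀ v, F ≤ v
  · exact Or.inl hbot
  push Not at hbot
  refine Or.inr ?_
  induction n with
  | zero =>
    obtain ⟨u, hu⟩ := hbot
    exact ⟨u, hu, fun v _ _ j hj => absurd hj (Nat.not_lt_zero j)⟩
  | succ n ih =>
    obtain ⟨u, hu, h⟩ := ih
    suffices ∃ u' < F, u ≤ u' ∧ ∀ v, u' < v → v ≤ F → (n ∈ v.1 ↔ n ∈ F.1) by
      obtain ⟨u', hu', huu', h'⟩ := this
      refine ⟨u', hu', fun v hv hvF j hj => ?_⟩
      rcases Nat.lt_succ_iff_lt_or_eq.1 hj with hj | rfl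
      · exact h v (huu'.trans_lt hv) hvF j hj
      · exact h' v hv hvF
    by_cases hn : n ∈ F.1
    · refine ⟨u, hu, le_rfl, fun v hv hvF => iff_of_true (by_contra fun hnv => ?_) hn⟩
      exact absurd (lt_iff.2 ⟨n, hn, hnv, fun j hj => (h v hv hvF j hj).symm⟩) (not_lt.2 hvF)
    · by_cases hG : insert n (F.1.filter (· < n)) ∈ T
      · let G : KleeneBrouwer T := ⟨_, hG⟩
        have hGmem : ∀ j, j ∈ G.1 ↔ j = n ∨ j ∈ F.1 ∧ j < n := by simp [G]
        refine ⟨max u G, max_lt hu ?_, le_max_left _ _, fun v hv hvF => iff_of_false (fun hnv => ?_) hn⟩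
        · refine lt_iff.2 ⟨n, (hGmem n).2 (Or.inl rfl), hn, fun j hj => ?_⟩
          rw [hGmem]
          simp [hj, hj.ne]
        · obtain ⟨m, hm, hmv, hmj⟩ := lt_iff.1 ((le_max_right _ _).trans_lt hv)
          have hagree := h v ((le_max_left _ _).trans_lt hv) hvF
          rcases (hGmem m).1 hm with rfl | ⟨h1, h2⟩
          · exact hmv hnv
          · exact hmv ((hagree m h2).2 h1)
      · refine ⟨u, hu, le_rfl, fun v hv hvF => iff_of_false (fun hnv => hG ?_) hn⟩
        have := hT v.1 v.2 (n + 1)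
        convert this using 1
        ext j
        simp only [Finset.mem_insert, Finset.mem_filter, Nat.lt_succ_iff_lt_or_eq]
        constructor
        · rintro (rfl | ⟨h1, h2⟩)
          · exact ⟨hnv, Or.inr rfl⟩
          · exact ⟨(h v hv hvF j h2).2 h1, Or.inl h2⟩
        · rintro ⟨h1, h2 | rfl⟩
          · exact Or.inr ⟨(h v hv hvF j h2).1 h1, h2⟩
          · exact Or.inl rfl

end KleeneBrouwer

/-! ### Continuous functions on compact well-ordered spaces. -/

section WellOrder

variable {W : Type*} [LinearOrder W] [WellFoundedLT W] [TopologicalSpace W] [OrderTopology W]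

theorem isOpen_Iic_of_wellFoundedLT (w : W) : IsOpen (Set.Iic w) := by
  by_cases h : (Set.Ioi w).Nonempty
  · have h1 : Set.Iic w = Set.Iio (WellFounded.min wellFounded_lt _ h) := by
      ext v
      refine ⟨fun hv => lt_of_le_of_lt hv (WellFounded.min_mem wellFounded_lt _ h), fun hv => ?_⟩
      exact not_lt.1 fun hvw => WellFounded.not_lt_min wellFounded_lt (Set.Ioi w) hvw hv
    rw [h1]
    exact isOpen_Iio
  · have h1 : Set.Iic w = Set.univ := Set.eq_univ_of_forall fun v => not_lt.1 fun hv => h ⟨v, hv⟩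
    rw [h1]
    exact isOpen_univ

/-- Since `Set.Iic w` is open, only the approach to w from the left matters. -/
theorem continuous_of_forall_Ioc {k : W → ℝ} (h : ∀ w, ∀ ε > 0, (∀ v, w ≤ v) ∨
    ∃ u < w, ∀ v, u < v → v ≤ w → |k v - k w| < ε) : Continuous k := by
  refine continuous_iff_continuousAt.2 fun w => Metric.tendsto_nhds.2 fun ε hε => ?_
  have hIic := (isOpen_Iic_of_wellFoundedLT w).mem_nhds (Set.mem_Iic.2 le_rfl)
  rcases h w ε hε with hw | ⟨u, hu, huw⟩
  · filter_upwards [hIic] with v hv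
    rw [le_antisymm hv (hw v), dist_self]
    exact hε
  · filter_upwards [hIic, Ioi_mem_nhds hu] with v hv hv'
    exact huw v hv' hv

/-- The indicator function of an initial segment. -/
noncomputable def initialIndicator (w : W) : C(W, ℝ) :=
  ⟨_, (LocallyConstant.charFn ℝ (U := Set.Iic w)
    ⟨isClosed_Iic, isOpen_Iic_of_wellFoundedLT w⟩).continuous⟩

theorem initialIndicator_of_le {v w : W} (h : v ≤ w) : initialIndicator w v = 1 :=
  Set.indicator_of_mem (s := Set.Iic w) h _

theorem initialIndicator_of_lt {v w : W} (h : w < v) : initialIndicator w v = 0 :=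
  Set.indicator_of_notMem (s := Set.Iic w) (not_le.2 h) _

variable [CompactSpace W]

/-- A bounded functional on `C(W, ℝ)` has small variation on some punctured left neighbourhood. -/
theorem exists_lt_forall_apply_le (T : C(W, ℝ) →L[ℝ] ℝ) (c : W) {ε : ℝ} (hε : 0 < ε) :
    (∀ v, c ≤ v) ∨ ∃ b < c, ∀ g : C(W, ℝ), (∀ w, |g w| ≤ 1) → (∀ w, w ≤ b ∨ c ≤ w → g w = 0) →
      T g ≤ ε := by
  by_contra hcon
  push Not at hcon
  obtain ⟨⟨b₀, hb₀⟩, hcon⟩ := hcon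
  -- Gliding hump: g is continuous and vanishes at c, so cutting it off shortly before c costs at
  -- most ε / 2. Humps obtained successively have disjoint supports, so their sums stay bounded by 1
  -- while the values of T grow without bound.
  have step : ∀ b < c, ∃ b' < c, b ≤ b' ∧ ∃ g : C(W, ℝ), (∀ w, |g w| ≤ 1) ∧
      (∀ w, w ≤ b ∨ b' < w → g w = 0) ∧ ε / 2 ≤ T g := by
    intro b hb
    obtain ⟨g, hg1, hg0, hgT⟩ := hcon b hb
    have hδ : 0 < ε / (2 * (‖T‖ + 1)) := by positivity
    have hnhds : {w | |g w| < ε / (2 * (‖T‖ + 1))} ∈ 𝓝 c := by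
      refine (isOpen_lt (by fun_prop) continuous_const).mem_nhds ?_
      simpa [hg0 c (Or.inr le_rfl)] using hδ
    obtain ⟨a, ha, hac⟩ := exists_Ioc_subset_of_mem_nhds hnhds ⟨b, hb⟩
    refine ⟨max a b, max_lt ha hb, le_max_right _ _, g * initialIndicator (max a b), ?_, ?_, ?_⟩
    · intro w
      rcases le_or_gt w (max a b) with h | h
      · simpa [initialIndicator_of_le h] using hg1 w
      · simp [initialIndicator_of_lt h]
    · rintro w (h | h)
      · simp [hg0 w (Or.inl h)]
      · simp [initialIndicator_of_lt h]
    · have hnorm : ‖g - g * initialIndicator (max a b)‖ ≤ ε / (2 * (‖T‖ + 1)) := by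
        refine (ContinuousMap.norm_le _ hδ.le).2 fun w => ?_
        rcases le_or_gt w (max a b) with h | h
        · simpa [initialIndicator_of_le h] using hδ.le
        · rcases le_or_gt w c with hw | hw
          · have := hac ⟨(le_max_left _ _).trans_lt h, hw⟩
            simpa [initialIndicator_of_lt h] using le_of_lt this
          · simpa [initialIndicator_of_lt h, hg0 w (Or.inr hw.le)] using hδ.le
      have h1 : T g - T (g * initialIndicator (max a b)) ≤ ‖T‖ * (ε / (2 * (‖T‖ + 1))) := by
        rw [← map_sub]
        exact (le_abs_self _).trans ((T.le_opNorm _).trans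
          (mul_le_mul_of_nonneg_left hnorm (norm_nonneg _)))
      have h2 : ‖T‖ * (ε / (2 * (‖T‖ + 1))) ≤ ε / 2 := by
        rw [mul_div_assoc', div_le_div_iff₀ (by positivity) two_pos]
        nlinarith [norm_nonneg T]
      linarith
  have iter : ∀ n : ℕ, ∀ b < c, ∃ g : C(W, ℝ), (∀ w, |g w| ≤ 1) ∧ (∀ w, w ≤ b → g w = 0) ∧
      n * (ε / 2) ≤ T g := by
    intro n
    induction n with
    | zero => exact fun b _ => ⟨0, by simp, by simp, by simp⟩
    | succ n ih =>
      intro b hb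
      obtain ⟨b', hb', hbb', g, hg1, hg0, hgT⟩ := step b hb
      obtain ⟨g', hg1', hg0', hgT'⟩ := ih b' hb'
      refine ⟨g + g', fun w => ?_, fun w hw => ?_, ?_⟩
      · rcases le_or_gt w b' with h | h
        · simpa [hg0' w h] using hg1 w
        · simpa [hg0 w (Or.inr h)] using hg1' w
      · simp [hg0 w (Or.inl hw), hg0' w (hw.trans hbb')]
      · rw [map_add]; push_cast; linarith
  obtain ⟨n, hn⟩ := exists_nat_gt (‖T‖ / (ε / 2))
  obtain ⟨g, hg1, -, hgT⟩ := iter n b₀ hb₀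
  have h1 : T g ≤ ‖T‖ * 1 := (le_abs_self _).trans ((T.le_opNorm _).trans
    (mul_le_mul_of_nonneg_left ((ContinuousMap.norm_le _ zero_le_one).2 hg1) (norm_nonneg _)))
  rw [div_lt_iff₀ (by positivity)] at hn
  linarith

/-- On a compact well-ordered space, bounded pointwise null sequences are weakly null. -/
theorem tendsto_apply_of_pointwise_null {z : ℕ → C(W, ℝ)} (hz1 : ∀ i w, |z i w| ≤ 1)
    (hz : ∀ w, Tendsto (fun i => z i w) atTop (𝓝 0)) (htop : ∃ t : W, ∀ w, w ≤ t)
    (T : C(W, ℝ) →L[ℝ] ℝ) : Tendsto (fun i => T (z i)) atTop (𝓝 0) := by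
  -- Transfinite induction on c. Beyond some b < c, the function is its value at c plus a bounded
  -- remainder vanishing outside (b, c), on which T is small; the part up to b is the induction
  -- hypothesis.
  have key : ∀ c, Tendsto (fun i => T (z i * initialIndicator c)) atTop (𝓝 0) := by
    intro c
    induction c using WellFoundedLT.induction with
    | ind c ih =>
      refine Metric.tendsto_nhds.2 fun ε hε => ?_
      rcases exists_lt_forall_apply_le T c (ε := ε / 8) (by positivity) with hc | ⟨b, hb, hbT⟩
      · have heq : ∀ i, T (z i * initialIndicator c) = z i c * T (initialIndicator c) := by
          intro i
          rw [← smul_eq_mul (z i c), ← map_smul T (z i c) (initialIndicator c)]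
          congr 1
          ext w
          rcases le_or_gt w c with h | h
          · simp [le_antisymm h (hc w)]
          · simp [initialIndicator_of_lt h]
        simp only [heq]
        exact Metric.tendsto_nhds.1 (by simpa using (hz c).mul_const _) ε hε
      · have h1 := Metric.tendsto_nhds.1 (ih b hb) (ε / 4) (by positivity)
        have h2 := Metric.tendsto_nhds.1 (show Tendsto (fun i => z i c *
          T (initialIndicator c - initialIndicator b)) atTop (𝓝 0) by
            simpa using (hz c).mul_const (T (initialIndicator c - initialIndicator b)))
            (ε / 4) (by positivity)
        filter_upwards [h1, h2] with i hi1 hi2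
        -- The factor 1 / 2 brings the difference of two values in [-1, 1] back into the unit ball.
        set g : C(W, ℝ) := (1 / 2 : ℝ) • ((z i - ContinuousMap.const W (z i c)) *
          (initialIndicator c - initialIndicator b)) with hg
        have hg1 : ∀ w, |g w| ≤ 1 := by
          intro w
          have hw : |z i w - z i c| ≤ 2 := by
            have := abs_le.1 (hz1 i w)
            have := abs_le.1 (hz1 i c)
            exact abs_le.2 ⟨by linarith, by linarith⟩
          rcases le_or_gt w b with h | h
          · simp [hg, initialIndicator_of_le h, initialIndicator_of_le (h.trans hb.le)]
          · rcases le_or_gt w c with h' | h'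
            · simp [hg, initialIndicator_of_lt h, initialIndicator_of_le h', abs_mul]
              linarith
            · simp [hg, initialIndicator_of_lt h, initialIndicator_of_lt h']
        have hg0 : ∀ w, w ≤ b ∨ c ≤ w → g w = 0 := by
          rintro w (h | h)
          · simp [hg, initialIndicator_of_le h, initialIndicator_of_le (h.trans hb.le)]
          · rcases h.eq_or_lt with rfl | h
            · simp [hg]
            · simp [hg, initialIndicator_of_lt h, initialIndicator_of_lt (hb.trans h)]
        have hT1 := hbT g hg1 hg0
        have hT2 := hbT (-g) (by simpa using hg1) (fun w hw => by simp [hg0 w hw])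
        have hsum : z i * initialIndicator c = z i * initialIndicator b +
            z i c • (initialIndicator c - initialIndicator b) + (2 : ℝ) • g := by
          ext w
          simp only [hg, ContinuousMap.mul_apply, ContinuousMap.add_apply, ContinuousMap.smul_apply,
            ContinuousMap.sub_apply, ContinuousMap.const_apply, smul_eq_mul]
          ring
        rw [hsum, map_add, map_add, map_smul, map_smul, smul_eq_mul, smul_eq_mul]
        rw [map_neg] at hT2
        rw [Real.dist_eq, sub_zero, abs_lt] at *
        constructor <;> linarith
  obtain ⟨t, ht⟩ := htop
  convert key t using 3 with i
  ext w
  simp [initialIndicator_of_le (ht w)]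

end WellOrder

/-! ### Countable well-ordered index sets and the sequences in `C(α)` they define. -/

namespace CountableSuccOrdinal

/-- Every countable well-ordered set with a greatest element is a countable successor ordinal. -/
theorem exists_orderIso {W : Type} [LinearOrder W] [WellFoundedLT W] [Countable W] {t : W}
    (ht : ∀ w, w ≤ t) : ∃ α : CountableSuccOrdinal.{u}, Nonempty (α.Space ≃o W) := by
  have hsucc : ∃ β, Ordinal.type (fun a b : W => a < b) = Order.succ β := by
    have h : ¬ Order.IsSuccPrelimit (Ordinal.type (fun a b : W => a < b)) := by
      rw [Ordinal.isSuccPrelimit_type_lt_iff]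
      intro h
      obtain ⟨w, hw⟩ := exists_gt t
      exact absurd (ht w) (not_le.2 hw)
    obtain ⟨β, hβ⟩ := Order.not_isSuccPrelimit_iff.1 h
    exact ⟨β, hβ.succ_eq.symm⟩
  let o : Ordinal.{u} := Ordinal.lift.{u} (Ordinal.type (fun a b : W => a < b))
  have hcard : o.card ≤ Cardinal.aleph0 := by
    simp only [o, ← Ordinal.lift_card, Ordinal.card_type, Cardinal.lift_le_aleph0]
    exact Cardinal.mk_le_aleph0
  have ho : ∃ β : Ordinal.{u}, o = Order.succ β := by
    obtain ⟨β, hβ⟩ := hsucc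
    exact ⟨Ordinal.lift.{u} β, by simp only [o, hβ, Ordinal.lift_succ]⟩
  have h : Ordinal.lift.{0} (Ordinal.type (fun a b : o.ToType => a < b)) =
      Ordinal.lift.{u} (Ordinal.type (fun a b : W => a < b)) := by
    rw [Ordinal.type_toType, Ordinal.lift_uzero]
  obtain ⟨e⟩ := Ordinal.lift_type_eq.{u, 0, 0}.1 h
  let α : CountableSuccOrdinal.{u} := ⟨o, hcard, ho⟩
  let e' : (fun a b : α.Space => a < b) ≃r (fun a b : W => a < b) := e
  exact ⟨α, ⟨OrderIso.ofRelIsoLT e'⟩⟩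

end CountableSuccOrdinal

/-- A set of real sequences is a continuous image (for the topology of pointwise convergence) of a
countable well-ordered set with a greatest element. -/
def IsWellOrderedImage (G : Set (ℕ → ℝ)) : Prop :=
  ∃ (W : Type) (_ : LinearOrder W) (_ : WellFoundedLT W) (_ : Countable W) (t : W)
    (k : W → ℕ → ℝ), (∀ w, w ≤ t) ∧ Set.range k = G ∧ ∀ w j, ∀ ε > 0, (∀ v, w ≤ v) ∨
      ∃ u < w, ∀ v, u < v → v ≤ w → |k v j - k w j| < ε

namespace IsWellOrderedImage

theorem image_smul {G : Set (ℕ → ℝ)} (hG : IsWellOrderedImage G) {r : ℝ} (hr : 0 < r) :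
    IsWellOrderedImage ((fun g => r • g) '' G) := by
  obtain ⟨W, _, _, _, t, k, ht, rfl, hk⟩ := hG
  refine ⟨W, inferInstance, inferInstance, inferInstance, t, fun w => r • k w, ht, ?_, ?_⟩
  · rw [← Set.range_comp]; rfl
  · intro w j ε hε
    refine (hk w j (ε / r) (by positivity)).imp id fun ⟨u, hu, h⟩ => ⟨u, hu, fun v hv hvw => ?_⟩
    have := h v hv hvw
    rw [lt_div_iff₀ hr] at this
    simpa [← mul_sub, abs_mul, abs_of_pos hr, mul_comm] using this

/-- The lexicographic sum places the second index set after the first; the greatest element of the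
first isolates the least element of the second from the left. -/
theorem union {G H : Set (ℕ → ℝ)} (hG : IsWellOrderedImage G) (hH : IsWellOrderedImage H) :
    IsWellOrderedImage (G ∪ H) := by
  obtain ⟨W, _, _, _, t, k, ht, rfl, hk⟩ := hG
  obtain ⟨W', _, _, _, t', k', ht', rfl, hk'⟩ := hH
  have hwf : WellFoundedLT (W ⊕ₗ W') :=
    ⟨Sum.lex_wf (wellFounded_lt (α := W)) (wellFounded_lt (α := W'))⟩
  refine ⟨W ⊕ₗ W', inferInstance, hwf, inferInstanceAs (Countable (W ⊕ W')),
    Sum.inrₗ t', fun w => Sum.elim k k' (ofLex w), ?_, ?_, ?_⟩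
  · rintro (w | w)
    · exact (Sum.Lex.inl_lt_inr w t').le
    · exact Sum.Lex.inr_le_inr_iff.2 (ht' w)
  · rw [← Set.Sum.elim_range]
    exact (ofLex.surjective).range_comp _
  · rintro (w | w) j ε hε
    · rcases hk w j ε hε with h | ⟨u, hu, h⟩
      · refine Or.inl ?_
        rintro (v | v)
        · exact Sum.Lex.inl_le_inl_iff.2 (h v)
        · exact (Sum.Lex.inl_lt_inr w v).le
      · refine Or.inr ⟨Sum.inlₗ u, Sum.Lex.inl_lt_inl_iff.2 hu, ?_⟩
        rintro (v | v) hv hvw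
        · exact h v (Sum.Lex.inl_lt_inl_iff.1 hv) (Sum.Lex.inl_le_inl_iff.1 hvw)
        · exact absurd hvw Sum.Lex.not_inr_le_inl
    · rcases hk' w j ε hε with h | ⟨u, hu, h⟩
      · refine Or.inr ⟨Sum.inlₗ t, Sum.Lex.inl_lt_inr t w, ?_⟩
        rintro (v | v) hv hvw
        · exact absurd (Sum.Lex.inl_lt_inl_iff.1 hv) (not_lt.2 (ht v))
        · have : v = w := le_antisymm (Sum.Lex.inr_le_inr_iff.1 hvw) (h v)
          subst this
          simpa using hε
      · refine Or.inr ⟨Sum.inrₗ u, Sum.Lex.inr_lt_inr_iff.2 hu, ?_⟩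
        rintro (v | v) hv hvw
        · exact absurd hv Sum.Lex.not_inr_lt_inl
        · exact h v (Sum.Lex.inr_lt_inr_iff.1 hv) (Sum.Lex.inr_le_inr_iff.1 hvw)

/-- The index set is ω + 1, with the limit at the top. -/
theorem of_tendsto {h : ℕ → ℕ → ℝ} {l : ℕ → ℝ}
    (hl : ∀ j, Tendsto (fun i => h i j) atTop (𝓝 (l j))) :
    IsWellOrderedImage (insert l (Set.range h)) := by
  refine ⟨WithTop ℕ, inferInstance, inferInstance, inferInstanceAs (Countable (Option ℕ)), ⊤,
    fun i => WithTop.recTopCoe (C := fun _ => ℕ → ℝ) l h i, fun _ => le_top, ?_, ?_⟩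
  · ext g
    simp only [Set.mem_range, Set.mem_insert_iff]
    constructor
    · rintro ⟨i, rfl⟩
      induction i using WithTop.recTopCoe with
      | top => exact Or.inl rfl
      | coe i => exact Or.inr ⟨i, rfl⟩
    · rintro (rfl | ⟨i, rfl⟩)
      · exact ⟨⊤, rfl⟩
      · exact ⟨(i : WithTop ℕ), rfl⟩
  · intro w j ε hε
    induction w using WithTop.recTopCoe with
    | top =>
      obtain ⟨n, hn⟩ := eventually_atTop.1 (Metric.tendsto_nhds.1 (hl j) ε hε)
      refine Or.inr ⟨(n : WithTop ℕ), WithTop.coe_lt_top n, fun v hv _ => ?_⟩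
      induction v using WithTop.recTopCoe with
      | top => simpa using hε
      | coe i => exact hn i (WithTop.coe_lt_coe.1 hv).le
    | coe i =>
      cases i with
      | zero => exact Or.inl fun v => bot_le
      | succ i =>
        refine Or.inr ⟨(i : WithTop ℕ), WithTop.coe_lt_coe.2 i.lt_succ_self, fun v hv hvi => ?_⟩
        induction v using WithTop.recTopCoe with
        | top => exact absurd hvi (not_le.2 (WithTop.coe_lt_top _))
        | coe m =>
          have : m = i + 1 := le_antisymm (WithTop.coe_le_coe.1 hvi) (WithTop.coe_lt_coe.1 hv)
          subst this
          simpa using hε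

/-- A well-founded tree of finite sets, mapped to sequences whose first terms depend only on an
initial segment of the set. -/
theorem of_tree {T : Set (Finset ℕ)} (hempty : ∅ ∈ T)
    (hT : ∀ F ∈ T, ∀ n, F.filter (· < n) ∈ T)
    (hwf : ∀ N : Set ℕ, N.Infinite → ∃ n, ∀ F ∈ T, ∃ j < n, ¬(j ∈ F ↔ j ∈ N))
    (g : Finset ℕ → ℕ → ℝ) (hg : ∀ F j, g (F.filter (· < j + 1)) j = g F j) :
    IsWellOrderedImage (g '' T) := by
  have := KleeneBrouwer.wellFounded hwf
  refine ⟨KleeneBrouwer T, inferInstance, inferInstance, inferInstance, ⟨∅, hempty⟩,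
    fun F => g F.1, fun F => KleeneBrouwer.le_of_eq_empty _ _ rfl, ?_, ?_⟩
  · rw [Set.image_eq_range]; rfl
  · intro F j ε hε
    refine (KleeneBrouwer.exists_lt_forall_agree hT F (j + 1)).imp id
      fun ⟨u, hu, h⟩ => ⟨u, hu, fun v hv hvF => ?_⟩
    have : v.1.filter (· < j + 1) = F.1.filter (· < j + 1) := by
      ext i
      simp only [Finset.mem_filter]
      exact and_congr_left fun hi => h v hv hvF i hi
    change |g v.1 j - g F.1 j| < ε
    rw [← hg v.1 j, this, hg F.1 j, sub_self, abs_zero]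
    exact hε

/-- The j-th function evaluates the j-th coordinate along the index set. Nullity of each member of G
is pointwise nullity of the functions, which suffices for weak nullity here. -/
theorem exists_continuousMap {G : Set (ℕ → ℝ)} (hG : IsWellOrderedImage G)
    (hbdd : ∀ g ∈ G, ∀ j, |g j| ≤ 1) (hone : ∀ j, ∃ g ∈ G, g j = 1)
    (hnull : ∀ g ∈ G, Tendsto g atTop (𝓝 0)) :
    ∃ (α : CountableSuccOrdinal.{u}) (z : ℕ → C(α.Space, ℝ)), IsNormalizedWeaklyNull z ∧
      (∀ s, ∃ g ∈ G, ∀ j, z j s = g j) ∧ ∀ g ∈ G, ∃ s, ∀ j, z j s = g j := by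
  obtain ⟨W, _, _, _, t, k, ht, rfl, hk⟩ := hG
  obtain ⟨α, ⟨e⟩⟩ := CountableSuccOrdinal.exists_orderIso.{u} ht
  let z : ℕ → C(α.Space, ℝ) := fun j => ⟨fun s => k (e s) j, by
    refine continuous_of_forall_Ioc fun w ε hε => ?_
    refine (hk (e w) j ε hε).imp (fun h v => e.le_iff_le.1 (h (e v))) ?_
    rintro ⟨u, hu, h⟩
    refine ⟨e.symm u, e.symm_apply_lt.2 hu, fun v hv hvw => h (e v) ?_ (e.le_iff_le.2 hvw)⟩
    exact e.symm_apply_lt.1 hv⟩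
  have hz : ∀ j s, z j s = k (e s) j := fun _ _ => rfl
  have hz1 : ∀ i s, |z i s| ≤ 1 := fun i s => hbdd _ ⟨_, rfl⟩ i
  refine ⟨α, z, ⟨fun i => le_antisymm ?_ ?_, fun T => ?_⟩, ?_, ?_⟩
  · exact (ContinuousMap.norm_le _ zero_le_one).2 (hz1 i)
  · obtain ⟨_, ⟨w, rfl⟩, hw⟩ := hone i
    have h1 := (z i).norm_coe_le_norm (e.symm w)
    rw [hz, e.apply_symm_apply, hw, norm_one] at h1
    exact h1
  · exact tendsto_apply_of_pointwise_null hz1 (fun s => hnull _ ⟨_, rfl⟩) α.exists_top T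
  · exact fun s => ⟨_, ⟨e s, rfl⟩, fun j => rfl⟩
  · rintro _ ⟨w, rfl⟩
    exact ⟨e.symm w, fun j => by rw [hz, e.apply_symm_apply]⟩

end IsWellOrderedImage

/-! ### Values of the dual ball and bounds on coefficients. -/

section DualBall

variable {X : Type u} [NormedAddCommGroup X] [NormedSpace ℝ X]

/-- The sequences of values on `x` of the functionals in the dual unit ball. -/
def dualBallValues (x : ℕ → X) : Set (ℕ → ℝ) :=
  {h | ∃ f : X →L[ℝ] ℝ, ‖f‖ ≤ 1 ∧ ∀ i, h i = f (x i)}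

theorem isCompact_dualBallValues (x : ℕ → X) : IsCompact (dualBallValues x) := by
  have h1 := WeakDual.isCompact_closedBall (𝕜 := ℝ) (E := X) 0 1
  have h2 : Continuous fun (f : WeakDual ℝ X) (i : ℕ) => f (x i) :=
    continuous_pi fun i => WeakDual.eval_continuous (x i)
  convert h1.image h2 using 1
  ext h
  constructor
  · rintro ⟨f, hf, hfh⟩
    exact ⟨StrongDual.toWeakDual f, by simpa using hf, funext fun i => (hfh i).symm⟩
  · rintro ⟨f, hf, rfl⟩
    exact ⟨WeakDual.toStrongDual f, by simpa using hf, fun i => rfl⟩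

theorem abs_sum_le_of_mem_dualBallValues {x : ℕ → X} {h : ℕ → ℝ} (hh : h ∈ dualBallValues x)
    (E : Finset ℕ) (b : ℕ → ℝ) : |∑ i ∈ E, b i * h i| ≤ ‖∑ i ∈ E, b i • x i‖ := by
  obtain ⟨f, hf, hfh⟩ := hh
  have : ∑ i ∈ E, b i * h i = f (∑ i ∈ E, b i • x i) := by
    simp [map_sum, hfh]
  rw [this]
  exact (f.le_opNorm _).trans (mul_le_of_le_one_left (norm_nonneg _) hf)

theorem exists_mem_dualBallValues_sum_eq (x : ℕ → X) (E : Finset ℕ) (b : ℕ → ℝ) :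
    ∃ h ∈ dualBallValues x, ∑ i ∈ E, b i * h i = ‖∑ i ∈ E, b i • x i‖ := by
  obtain ⟨f, hf, hfx⟩ := exists_dual_vector'' ℝ (∑ i ∈ E, b i • x i)
  refine ⟨fun i => f (x i), ⟨f, hf, fun _ => rfl⟩, ?_⟩
  simpa [map_sum] using hfx

theorem sum_quarter_pow_le (E : Finset ℕ) : ∑ i ∈ E, (1 / 4 : ℝ) ^ i ≤ 2 := by
  have h := (summable_geometric_of_lt_one (r := (1 / 4 : ℝ)) (by norm_num) (by norm_num)).sum_le_tsum
    E (fun i _ => by positivity)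
  rw [tsum_geometric_of_lt_one (by norm_num) (by norm_num)] at h
  norm_num at h ⊢
  linarith

/-- An almost biorthogonal system bounds the coefficients. -/
theorem abs_coeff_le {y : ℕ → X} {h : ℕ → ℕ → ℝ} {l : ℕ → ℝ} (hh : ∀ i, h i ∈ dualBallValues y)
    (hl : l ∈ dualBallValues y) (h1 : ∀ i, h i i = 1) (hl1 : ∀ i, |l i| ≤ 1 / 4)
    (hhl : ∀ i j, i ≠ j → |h i j - l j| ≤ 1 / 8 * (1 / 4) ^ j) (E : Finset ℕ) (b : ℕ → ℝ) {i : ℕ}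
    (hi : i ∈ E) : |b i| ≤ 4 * ‖∑ i ∈ E, b i • y i‖ := by
  obtain ⟨m, hm, hmax⟩ := E.exists_max_image (fun i => |b i|) ⟨i, hi⟩
  refine (hmax i hi).trans ?_
  have e1 := abs_le.1 (abs_sum_le_of_mem_dualBallValues (hh m) E b)
  have e2 := abs_le.1 (abs_sum_le_of_mem_dualBallValues hl E b)
  -- Testing against h m - l isolates the largest coefficient: subtracting l removes the values of h
  -- m at the other indices, up to a summable error. In total 3/4 |b m| ≤ 2‖·‖ + 1/4 |b m|.
  have e3 : ∑ i ∈ E, b i * h m i - ∑ i ∈ E, b i * l i =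
      b m * (1 - l m) + ∑ i ∈ E.erase m, b i * (h m i - l i) := by
    rw [← Finset.sum_sub_distrib, ← Finset.add_sum_erase E _ hm, h1]
    congr 1
    · ring
    · exact Finset.sum_congr rfl fun i _ => by ring
  have e4 : |∑ i ∈ E.erase m, b i * (h m i - l i)| ≤ |b m| * (1 / 4) := by
    calc |∑ i ∈ E.erase m, b i * (h m i - l i)|
        ≤ ∑ i ∈ E.erase m, |b i * (h m i - l i)| := Finset.abs_sum_le_sum_abs _ _
      _ ≤ ∑ i ∈ E.erase m, |b m| * (1 / 8) * (1 / 4) ^ i := by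
          refine Finset.sum_le_sum fun i hi => ?_
          rw [abs_mul, mul_assoc]
          exact mul_le_mul (hmax i (Finset.mem_of_mem_erase hi))
            (hhl m i (Finset.ne_of_mem_erase hi).symm) (abs_nonneg _) (abs_nonneg _)
      _ ≤ |b m| * (1 / 4) := by
          rw [← Finset.mul_sum]
          nlinarith [sum_quarter_pow_le (E.erase m), abs_nonneg (b m)]
  have e5 : |b m| * (3 / 4) ≤ |b m * (1 - l m)| := by
    rw [abs_mul]
    refine mul_le_mul_of_nonneg_left ?_ (abs_nonneg _)
    have := abs_le.1 (hl1 m)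
    exact le_trans (by linarith) (le_abs_self _)
  have e6 : |b m * (1 - l m)| ≤ 2 * ‖∑ i ∈ E, b i • y i‖ + |b m| * (1 / 4) := by
    have e7 := abs_le.1 e4
    exact abs_le.2 ⟨by linarith, by linarith⟩
  linarith

end DualBall

/-- Iterated limits along the tree of finite sets, realized along a subsequence. -/
theorem exists_subsequence_iterated_limit {D : Set (ℕ → ℝ)} (hD : IsCompact D)
    (hnull : ∀ h ∈ D, Tendsto h atTop (𝓝 0)) {S : Set (Finset ℕ)}
    (hS : ∀ N : Set ℕ, N.Infinite → ∃ A ∈ S, (A : Set ℕ) ⊆ N)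
    (hup : ∀ A ∈ S, ∀ B, A ⊆ B → B ∈ S) {c : Finset ℕ → ℕ → ℝ} (hc : ∀ A ∈ S, c A ∈ D)
    {h : ℕ → ℕ → ℝ} (hh : ∀ i, h i ∈ D) {η : ℝ} (hη : 0 < η) :
    ∃ (φ : ℕ → ℕ) (f : Finset ℕ → ℕ → ℝ) (l : ℕ → ℝ), StrictMono φ ∧ l ∈ D ∧ (∀ F, f F ∈ D) ∧
      (∀ A ∈ S, f A = c A) ∧
      (∀ k, ∀ F ∉ S, F ⊆ (Finset.range k).image φ → ∀ j < k,
        |f (insert (φ k) F) (φ j) - f F (φ j)| ≤ η * (1 / 4) ^ k) ∧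
      (∀ k, ∀ i < k, |h (φ k) (φ i) - l (φ i)| ≤ η * (1 / 4) ^ k) ∧
      (∀ k, ∀ i < k, |h (φ i) (φ k) - l (φ k)| ≤ η * (1 / 4) ^ k) ∧
      ∀ k, |l (φ k)| ≤ 1 / 4 := by
  -- Each condition imposed on the next index n involves finitely many sets and coordinates already
  -- chosen. It holds for hyperfilter-many n, either by a limit along the hyperfilter or because
  -- members of D are null.
  obtain ⟨f, hfD, hfS, hf⟩ := exists_iterated_limit hD hS hup hc
  obtain ⟨l, hl, hlim⟩ := hD.ultrafilter_le_nhds ((hyperfilter ℕ).map h) (by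
    rw [le_principal_iff, Ultrafilter.coe_map, Filter.mem_map]
    exact Filter.univ_mem' hh)
  have hlim : Tendsto h (hyperfilter ℕ) (𝓝 l) := hlim
  obtain ⟨φ, hφ, hP⟩ := exists_strictMono_forall (l := (hyperfilter ℕ : Filter ℕ))
    Nat.hyperfilter_le_atTop
    (P := fun k s n => (∀ F ∈ s.powerset, F ∉ S → ∀ j ∈ s,
        |f (insert n F) j - f F j| ≤ η * (1 / 4) ^ k) ∧
      (∀ i ∈ s, |h n i - l i| ≤ η * (1 / 4) ^ k) ∧ (∀ i ∈ s, |h i n - l n| ≤ η * (1 / 4) ^ k) ∧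
      |l n| ≤ 1 / 4) (by
    intro k s
    have hε : 0 < η * (1 / 4) ^ k := by positivity
    have hclose : ∀ {u : ℕ → ℝ} {a ε : ℝ}, 0 < ε → Tendsto u (hyperfilter ℕ) (𝓝 a) →
        ∀ᶠ n in (hyperfilter ℕ : Filter ℕ), |u n - a| ≤ ε := fun hε hu =>
      (Metric.tendsto_nhds.1 hu _ hε).mono fun n hn => le_of_lt hn
    have hn : ∀ {h : ℕ → ℝ}, h ∈ D → Tendsto h (hyperfilter ℕ) (𝓝 0) := fun hm =>
      (hnull _ hm).mono_left Nat.hyperfilter_le_atTop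
    refine ((Finset.eventually_all _).2 fun F _ => ?_).and
      (((Finset.eventually_all _).2 fun i _ => ?_).and
        (((Finset.eventually_all _).2 fun i _ => ?_).and ?_))
    · by_cases hF : F ∈ S
      · exact Eventually.of_forall fun n h' => absurd hF h'
      · have := (Finset.eventually_all s).2 fun j _ =>
          hclose hε (tendsto_pi_nhds.1 (hf F hF) j)
        exact this.mono fun n hn _ => hn
    · exact hclose hε (tendsto_pi_nhds.1 hlim i)
    · simpa using hclose hε ((hn (hh i)).sub (hn hl))
    · simpa using hclose (ε := 1 / 4) (by norm_num) (hn hl))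
  refine ⟨φ, f, l, hφ, hl, hfD, hfS, ?_, ?_, ?_, fun k => (hP k).2.2.2⟩
  · exact fun k F hF hFk j hj => (hP k).1 F (Finset.mem_powerset.2 hFk) hF _
      (Finset.mem_image_of_mem _ (Finset.mem_range.2 hj))
  · exact fun k i hi => (hP k).2.1 _ (Finset.mem_image_of_mem _ (Finset.mem_range.2 hi))
  · exact fun k i hi => (hP k).2.2.1 _ (Finset.mem_image_of_mem _ (Finset.mem_range.2 hi))

/-! ### A common form of the four constants. -/

section SeqConst

variable {X : Type u} [NormedAddCommGroup X] [NormedSpace ℝ X]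

/-- `a` and `E` satisfy the side condition `Q` and violate the projection inequality with
constant `C`. -/
def Violates (Q : (ℕ →₀ ℝ) → Finset ℕ → ℝ → Prop) (C : ℝ) (x : ℕ → X) (a : ℕ →₀ ℝ)
    (E : Finset ℕ) : Prop :=
  Q a E ‖∑ i ∈ a.support, a i • x i‖ ∧
    C * ‖∑ i ∈ a.support, a i • x i‖ < ‖∑ i ∈ E, a i • x i‖

/-- The optimal constant in the projection inequality under the side condition `Q`. -/
noncomputable def seqConst (Q : (ℕ →₀ ℝ) → Finset ℕ → ℝ → Prop) (x : ℕ → X) : EReal :=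
  ⨅ (C : ℝ) (_ : ∀ a E, Q a E ‖∑ i ∈ a.support, a i • x i‖ →
    ‖∑ i ∈ E, a i • x i‖ ≤ C * ‖∑ i ∈ a.support, a i • x i‖), (C : EReal)

/-- Properties shared by the side conditions in the definitions of the four constants. -/
structure IsSideCondition (Q : (ℕ →₀ ℝ) → Finset ℕ → ℝ → Prop) : Prop where
  embDomain_iff : ∀ (φ : ℕ ↪ ℕ) a E r, Q (a.embDomain φ) (E.map φ) r ↔ Q a E r
  anti : ∀ a E r r', r' ≤ r → Q a E r → Q a E r'
  single : ∀ r ≤ 1, Q (Finsupp.single 0 1) {0} r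

variable {Q : (ℕ →₀ ℝ) → Finset ℕ → ℝ → Prop}

theorem exists_violates_of_lt {C : ℝ} {x : ℕ → X} (h : (C : EReal) < seqConst Q x) :
    ∃ a E, Violates Q C x a E := by
  by_contra hcon
  refine absurd h (not_lt.2 (iInf₂_le C fun a E hQ => ?_))
  by_contra hlt
  exact hcon ⟨a, E, hQ, not_le.1 hlt⟩

theorem le_seqConst_of_violates {C : ℝ} {x : ℕ → X} {a E} (h : Violates Q C x a E) :
    (C : EReal) ≤ seqConst Q x := by
  refine le_iInf₂ fun C' hC' => EReal.coe_le_coe_iff.2 ?_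
  by_contra hlt
  have h1 := hC' a E h.1
  have h2 := mul_le_mul_of_nonneg_right (not_le.1 hlt).le
    (norm_nonneg (∑ i ∈ a.support, a i • x i))
  exact absurd h.2 (not_lt.2 (h1.trans h2))

/-- This lower bound allows the comparison constant C to be taken nonnegative. -/
theorem one_le_seqConst (hQ : IsSideCondition Q) {x : ℕ → X} (hx : ‖x 0‖ = 1) :
    (1 : EReal) ≤ seqConst Q x := by
  refine le_iInf₂ fun C hC => ?_
  have hsupp : (Finsupp.single 0 1 : ℕ →₀ ℝ).support = {0} :=
    by simp
  have := hC (Finsupp.single 0 1) {0}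
  simp only [hsupp, Finset.sum_singleton, Finsupp.single_eq_same, one_smul, hx, mul_one] at this
  exact_mod_cast this (hQ.single 1 le_rfl)

theorem violates_embDomain_iff (hQ : IsSideCondition Q) (φ : ℕ ↪ ℕ) (C : ℝ) (x : ℕ → X)
    (a : ℕ →₀ ℝ) (E : Finset ℕ) :
    Violates Q C x (a.embDomain φ) (E.map φ) ↔ Violates Q C (x ∘ φ) a E := by
  simp only [Violates, Finsupp.support_embDomain, Finset.sum_map, Finsupp.embDomain_apply_self,
    hQ.embDomain_iff, Function.comp_apply]

theorem exists_eq_embDomain (φ : ℕ ↪ ℕ) {a : ℕ →₀ ℝ} {E : Finset ℕ}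
    (ha : (a.support : Set ℕ) ⊆ Set.range φ) (hE : (E : Set ℕ) ⊆ Set.range φ) :
    ∃ (b : ℕ →₀ ℝ) (F : Finset ℕ), a = b.embDomain φ ∧ E = F.map φ := by
  classical
  refine ⟨a.comapDomain φ φ.injective.injOn, E.preimage φ φ.injective.injOn, ?_, ?_⟩
  · rw [Finsupp.embDomain_eq_mapDomain, Finsupp.mapDomain_comapDomain _ φ.injective _ ha]
  · ext i
    simp only [Finset.mem_map, Finset.mem_preimage]
    refine ⟨fun hi => ?_, ?_⟩
    · obtain ⟨j, rfl⟩ := hE hi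
      exact ⟨j, hi, rfl⟩
    · rintro ⟨j, hj, rfl⟩
      exact hj

end SeqConst

/-! ### The tree of initial segments that carry no witness. -/

/-- The family of sets whose initial segments, transported along `φ`, lie outside `S`. -/
def initialTree (S : Set (Finset ℕ)) (φ : ℕ → ℕ) : Set (Finset ℕ) :=
  {F | ∀ k ∈ F, (F.filter (· < k)).image φ ∉ S}

theorem filter_mem_initialTree {S : Set (Finset ℕ)} {φ : ℕ → ℕ} {F : Finset ℕ}
    (hF : F ∈ initialTree S φ) (n : ℕ) : F.filter (· < n) ∈ initialTree S φ := by
  intro k hk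
  rw [Finset.mem_filter] at hk
  have : (F.filter (· < n)).filter (· < k) = F.filter (· < k) := by
    ext i
    simp only [Finset.mem_filter]
    exact ⟨fun h => ⟨h.1.1, h.2⟩, fun h => ⟨⟨h.1, h.2.trans hk.2⟩, h.2⟩⟩
  rw [this]
  exact hF k hk.1

/-- The shortest initial segment of N whose image is in S works: by minimality its proper initial
segments are outside S. -/
theorem exists_mem_initialTree {S : Set (Finset ℕ)}
    (hS : ∀ N : Set ℕ, N.Infinite → ∃ A ∈ S, (A : Set ℕ) ⊆ N)
    (hup : ∀ A ∈ S, ∀ B, A ⊆ B → B ∈ S) {φ : ℕ → ℕ} (hφ : StrictMono φ) {N : Set ℕ}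
    (hN : N.Infinite) : ∃ n, ∃ A ∈ initialTree S φ, A.image φ ∈ S ∧ ∀ j, j ∈ A ↔ j ∈ N ∧ j < n := by
  classical
  let A : ℕ → Finset ℕ := fun n => (Finset.range n).filter (· ∈ N)
  have hA : ∀ n j, j ∈ A n ↔ j ∈ N ∧ j < n := fun n j => by simp [A, and_comm]
  have hex : ∃ n, (A n).image φ ∈ S := by
    obtain ⟨B, hB, hBN⟩ := hS (φ '' N) (hN.image hφ.injective.injOn)
    refine ⟨B.sup id + 1, hup B hB _ fun i hi => ?_⟩
    obtain ⟨j, hj, rfl⟩ := hBN hi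
    refine Finset.mem_image_of_mem _ ((hA _ _).2 ⟨hj, Nat.lt_succ_of_le ?_⟩)
    exact hφ.le_apply.trans (Finset.le_sup (f := id) hi)
  refine ⟨Nat.find hex, A (Nat.find hex), fun k hk => ?_, Nat.find_spec hex, hA _⟩
  have hk' := ((hA _ _).1 hk).2
  have : (A (Nat.find hex)).filter (· < k) = A k := by
    ext j
    simp only [Finset.mem_filter, hA]
    exact ⟨fun h => ⟨h.1.1, h.2⟩, fun h => ⟨⟨h.1, h.2.trans hk'⟩, h.2⟩⟩
  rw [this]
  exact Nat.find_min hex hk'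

/-- An initial segment A of N already has image in S. If F agreed with N up to and including an
element k of N beyond A, its proper initial segment below k would contain A, which membership in the
tree forbids. -/
theorem exists_disagree_of_initialTree {S : Set (Finset ℕ)}
    (hS : ∀ N : Set ℕ, N.Infinite → ∃ A ∈ S, (A : Set ℕ) ⊆ N)
    (hup : ∀ A ∈ S, ∀ B, A ⊆ B → B ∈ S) {φ : ℕ → ℕ} (hφ : StrictMono φ) {N : Set ℕ}
    (hN : N.Infinite) : ∃ n, ∀ F ∈ initialTree S φ, ∃ j < n, ¬(j ∈ F ↔ j ∈ N) := by
  obtain ⟨n, A, -, hAS, hA⟩ := exists_mem_initialTree hS hup hφ hN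
  obtain ⟨k, hk, hnk⟩ := hN.exists_gt n
  refine ⟨k + 1, fun F hF => ?_⟩
  by_contra hcon
  push Not at hcon
  refine hF k ((hcon k k.lt_succ_self).2 hk) (hup _ hAS _ (Finset.image_subset_image fun j hj => ?_))
  obtain ⟨h1, h2⟩ := (hA j).1 hj
  have h3 : j < k := h2.trans hnk
  exact Finset.mem_filter.2 ⟨(hcon j (h3.trans k.lt_succ_self)).2 h1, h3⟩

/-- Along the tree, the values of the iterated limits stabilize geometrically. -/
theorem abs_sub_initial_le {S : Set (Finset ℕ)} {φ : ℕ → ℕ} {f : Finset ℕ → ℕ → ℝ} {η : ℝ}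
    (hη : 0 < η) (hf : ∀ k, ∀ F ∉ S, F ⊆ (Finset.range k).image φ → ∀ j < k,
        |f (insert (φ k) F) (φ j) - f F (φ j)| ≤ η * (1 / 4) ^ k)
    {F : Finset ℕ} (hF : F ∈ initialTree S φ) (m : ℕ) :
    |f (F.image φ) (φ m) - f ((F.filter (· < m + 1)).image φ) (φ m)| ≤ η * (1 / 4) ^ m := by
  -- The subtracted term reserves room for the errors still to come: it shrinks by a factor 4 at
  -- each step and so releases 3/2 of the new error.
  have key : ∀ n, |f ((F.filter (· < m + 1 + n)).image φ) (φ m) -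
      f ((F.filter (· < m + 1)).image φ) (φ m)| ≤
        η * (1 / 4) ^ m - 2 * (η * (1 / 4) ^ (m + 1 + n)) := by
    intro n
    induction n with
    | zero =>
      have : 0 < η * (1 / 4 : ℝ) ^ m := by positivity
      simp only [add_zero, sub_self, abs_zero, pow_succ]
      linarith
    | succ n ih =>
      have hpos : 0 < η * (1 / 4 : ℝ) ^ (m + 1 + n) := by positivity
      have hpow : η * (1 / 4 : ℝ) ^ (m + 1 + (n + 1)) = η * (1 / 4 : ℝ) ^ (m + 1 + n) / 4 := by
        rw [← add_assoc, pow_succ]; ring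
      by_cases hn : m + 1 + n ∈ F
      · have h1 : (F.filter (· < m + 1 + (n + 1))).image φ =
            insert (φ (m + 1 + n)) ((F.filter (· < m + 1 + n)).image φ) := by
          rw [← Finset.image_insert]
          congr 1
          ext j
          simp only [Finset.mem_filter, Finset.mem_insert]
          constructor
          · rintro ⟨h1, h2⟩
            by_cases h3 : j = m + 1 + n
            · exact Or.inl h3
            · exact Or.inr ⟨h1, by omega⟩
          · rintro (rfl | ⟨h1, h2⟩)
            · exact ⟨hn, by omega⟩
            · exact ⟨h1, by omega⟩
        have h2 := hf (m + 1 + n) _ (hF _ hn) (Finset.image_subset_image fun j hj =>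
          Finset.mem_range.2 (Finset.mem_filter.1 hj).2) m (by omega)
        rw [h1, hpow]
        have h3 := abs_le.1 h2
        have h4 := abs_le.1 ih
        exact abs_le.2 ⟨by linarith, by linarith⟩
      · have h1 : F.filter (· < m + 1 + (n + 1)) = F.filter (· < m + 1 + n) := by
          ext j
          simp only [Finset.mem_filter]
          refine and_congr_right fun hj => ⟨fun h => ?_, fun h => by omega⟩
          have : j ≠ m + 1 + n := fun h => hn (h ▸ hj)
          omega
        rw [h1, hpow]
        linarith
  have h1 : F.filter (· < m + 1 + (F.sup id)) = F :=
    Finset.filter_true_of_mem fun j hj => by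
      have := Finset.le_sup (f := id) hj
      simp only [id] at this
      omega
  have h2 := key (F.sup id)
  rw [h1] at h2
  have : 0 < η * (1 / 4 : ℝ) ^ (m + 1 + F.sup id) := by positivity
  linarith

/-! ### Modelling a sequence on a countable successor ordinal. -/

section Model

variable {X : Type u} [NormedAddCommGroup X] [NormedSpace ℝ X]

theorem tendsto_zero_of_mem_dualBallValues {x : ℕ → X} (hx : IsNormalizedWeaklyNull x)
    {h : ℕ → ℝ} (hh : h ∈ dualBallValues x) : Tendsto h atTop (𝓝 0) := by
  obtain ⟨f, -, hf⟩ := hh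
  exact (hx.weakly_null f).congr fun i => (hf i).symm

theorem comp_mem_dualBallValues {x : ℕ → X} {h : ℕ → ℝ} (hh : h ∈ dualBallValues x) (φ : ℕ → ℕ) :
    h ∘ φ ∈ dualBallValues (x ∘ φ) := by
  obtain ⟨f, hf, hfh⟩ := hh
  exact ⟨f, hf, fun i => hfh (φ i)⟩

/-- A normalized weakly null sequence all of whose subsequences violate an inequality is modelled
on a sequence of continuous functions on a countable successor ordinal. -/
theorem exists_continuousMap_violates {Q : (ℕ →₀ ℝ) → Finset ℕ → ℝ → Prop}
    (hQ : IsSideCondition Q) {x : ℕ → X} (hx : IsNormalizedWeaklyNull x) {C C' : ℝ} (hC : 0 ≤ C)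
    (hCC' : C < C') (hviol : ∀ φ : ℕ → ℕ, StrictMono φ → ∃ a E, Violates Q C' (x ∘ φ) a E) :
    ∃ (α : CountableSuccOrdinal.{u}) (z : ℕ → C(α.Space, ℝ)), IsNormalizedWeaklyNull z ∧
      ∀ φ : ℕ → ℕ, StrictMono φ → ∃ a E, Violates Q C (z ∘ φ) a E := by
  classical
  -- the sets that carry a witness
  let S : Set (Finset ℕ) := {A | ∃ a E, ∃ h ∈ dualBallValues x, a.support ⊆ A ∧ E ⊆ A ∧
    Q a E ‖∑ i ∈ a.support, a i • x i‖ ∧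
      C' * ‖∑ i ∈ a.support, a i • x i‖ < ∑ i ∈ E, a i * h i}
  have hup : ∀ A ∈ S, ∀ B, A ⊆ B → B ∈ S := by
    rintro A ⟨a, E, h, hh, ha, hE, hrest⟩ B hAB
    exact ⟨a, E, h, hh, ha.trans hAB, hE.trans hAB, hrest⟩
  have hS : ∀ N : Set ℕ, N.Infinite → ∃ A ∈ S, (A : Set ℕ) ⊆ N := by
    intro N hN
    have : Infinite N := hN.to_subtype
    let φ := Nat.orderEmbeddingOfSet N
    obtain ⟨b, F, hb⟩ := hviol φ φ.strictMono
    have hb' := (violates_embDomain_iff hQ φ.toEmbedding C' x b F).2 hb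
    obtain ⟨h, hh, hsum⟩ := exists_mem_dualBallValues_sum_eq x (F.map φ.toEmbedding)
      (b.embDomain φ.toEmbedding)
    refine ⟨_, ⟨b.embDomain φ.toEmbedding, F.map φ.toEmbedding, h, hh, Finset.subset_union_left,
      Finset.subset_union_right, hb'.1, ?_⟩, ?_⟩
    · rw [hsum]; exact hb'.2
    · rw [Finsupp.support_embDomain, ← Finset.map_union]
      intro i hi
      obtain ⟨j, -, rfl⟩ := Finset.mem_map.1 (Finset.mem_coe.1 hi)
      exact Nat.orderEmbeddingOfSet_range N ▸ Set.mem_range_self j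
  choose! a E c hcD haA hEA hcQ hcV using fun A (hA : A ∈ S) => hA
  have hnorming : ∀ i, ∃ h ∈ dualBallValues x, h i = 1 := fun i => by
    obtain ⟨h, hh, hi⟩ := exists_mem_dualBallValues_sum_eq x {i} 1
    exact ⟨h, hh, by simpa [hx.norm_eq_one i] using hi⟩
  choose h hhD hh1 using hnorming
  -- the perturbation parameter
  obtain ⟨η, hη0, hη8, hηC⟩ : ∃ η : ℝ, 0 < η ∧ η ≤ 1 / 8 ∧ C * (1 + 8 * η) ≤ C' - 8 * η := by
    have h1 : 0 < (C' - C) / (8 * (1 + C)) := div_pos (by linarith) (by linarith)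
    refine ⟨min (1 / 8) ((C' - C) / (8 * (1 + C))), lt_min (by norm_num) h1, min_le_left _ _, ?_⟩
    have h2 := min_le_right (1 / 8) ((C' - C) / (8 * (1 + C)))
    rw [le_div_iff₀ (by linarith)] at h2
    linarith
  obtain ⟨φ, f, l, hφ, hlD, hfD, hfS, hf, hhl1, hhl2, hl4⟩ :=
    exists_subsequence_iterated_limit (isCompact_dualBallValues x)
      (fun _ => tendsto_zero_of_mem_dualBallValues hx) hS hup hcD hhD hη0
  set y : ℕ → X := x ∘ φ with hy
  let h' : ℕ → ℕ → ℝ := fun i => h (φ i) ∘ φ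
  let l' : ℕ → ℝ := l ∘ φ
  have hpow : ∀ j : ℕ, η * (1 / 4 : ℝ) ^ j ≤ 1 / 8 * (1 / 4) ^ j := fun j =>
    mul_le_mul_of_nonneg_right hη8 (by positivity)
  have hcoeff : ∀ (E : Finset ℕ) (b : ℕ → ℝ) {i : ℕ}, i ∈ E →
      |b i| ≤ 4 * ‖∑ i ∈ E, b i • y i‖ := by
    intro E b i hi
    refine abs_coeff_le (h := h') (l := l') (fun i => comp_mem_dualBallValues (hhD _) φ)
      (comp_mem_dualBallValues hlD φ) (fun i => hh1 _) hl4 (fun i j hij => ?_) E b hi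
    rcases lt_or_gt_of_ne hij with hij | hij
    · exact (hhl2 j i hij).trans (hpow j)
    · refine (hhl1 i j hij).trans ((hpow i).trans ?_)
      exact mul_le_mul_of_nonneg_left
        (pow_le_pow_of_le_one (by norm_num) (by norm_num) hij.le) (by norm_num)
  -- the family of perturbed functionals
  let T := initialTree S φ
  -- Elements up to m are kept, m included: adding the element k is controlled only at coordinates
  -- below k. This truncation makes `g F m` depend on an initial segment of F alone, which gives
  -- continuity.
  let g : Finset ℕ → ℕ → ℝ := fun F m => f ((F.filter (· < m + 1)).image φ) (φ m)
  have hgf : ∀ F ∈ T, ∀ m, |f (F.image φ) (φ m) - g F m| ≤ η * (1 / 4) ^ m :=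
    fun F hF m => abs_sub_initial_le hη0 hf hF m
  have hgsum : ∀ F ∈ T, ∀ (E : Finset ℕ) (b : ℕ → ℝ) (r : ℝ), (∀ i ∈ E, |b i| ≤ 4 * r) → 0 ≤ r →
      |∑ i ∈ E, b i * f (F.image φ) (φ i) - ∑ i ∈ E, b i * g F i| ≤ 8 * η * r := by
    intro F hF E b r hb hr
    rw [← Finset.sum_sub_distrib]
    calc |∑ i ∈ E, (b i * f (F.image φ) (φ i) - b i * g F i)|
        ≤ ∑ i ∈ E, |b i * f (F.image φ) (φ i) - b i * g F i| := Finset.abs_sum_le_sum_abs _ _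
      _ ≤ ∑ i ∈ E, 4 * r * η * (1 / 4) ^ i := by
          refine Finset.sum_le_sum fun i hi => ?_
          rw [← mul_sub, abs_mul, mul_assoc (4 * r)]
          exact mul_le_mul (hb i hi) (hgf F hF i) (abs_nonneg _) (by positivity)
      _ ≤ 8 * η * r := by
          rw [← Finset.mul_sum]
          have := mul_le_mul_of_nonneg_left (sum_quarter_pow_le E)
            (show 0 ≤ 4 * r * η by positivity)
          linarith
  have hη1 : 0 < 1 + 8 * η := by positivity
  -- The tree part carries the violations; the norming functionals `h'`, closed up by their limit
  -- `l'`, give each coordinate the value 1 somewhere.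
  let G : Set (ℕ → ℝ) := (fun k => (1 + 8 * η)⁻¹ • k) '' (g '' T) ∪ insert l' (Set.range h')
  have hGimage : IsWellOrderedImage G := by
    refine IsWellOrderedImage.union (IsWellOrderedImage.image_smul ?_ (by positivity)) ?_
    · refine IsWellOrderedImage.of_tree (fun k hk => absurd hk (Finset.notMem_empty k))
        (fun F hF => filter_mem_initialTree hF)
        (fun N => exists_disagree_of_initialTree hS hup hφ) g fun F j => ?_
      simp only [g, Finset.filter_filter, and_self]
    · refine IsWellOrderedImage.of_tendsto fun j => ?_
      have h0 : Tendsto (fun i : ℕ => η * (1 / 4 : ℝ) ^ i) atTop (𝓝 0) := by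
        simpa using (tendsto_pow_atTop_nhds_zero_of_lt_one (r := (1 / 4 : ℝ)) (by norm_num)
          (by norm_num)).const_mul η
      refine tendsto_iff_dist_tendsto_zero.2 (squeeze_zero' (Eventually.of_forall fun _ =>
        dist_nonneg) ?_ h0)
      filter_upwards [eventually_gt_atTop j] with i hi
      exact hhl1 i j hi
  have hGsum : ∀ k ∈ G, ∀ (E : Finset ℕ) (b : ℕ → ℝ),
      |∑ i ∈ E, b i * k i| ≤ ‖∑ i ∈ E, b i • y i‖ := by
    rintro k (⟨_, ⟨F, hF, rfl⟩, rfl⟩ | rfl | ⟨i, rfl⟩) E b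
    · have h1 := abs_le.1 (hgsum F hF E b _ (fun i hi => hcoeff E b hi) (norm_nonneg _))
      have h2 := abs_le.1 (abs_sum_le_of_mem_dualBallValues
        (comp_mem_dualBallValues (hfD (F.image φ)) φ) E b)
      have h3 : ∑ i ∈ E, b i * ((1 + 8 * η)⁻¹ • g F) i =
          (1 + 8 * η)⁻¹ * ∑ i ∈ E, b i * g F i := by
        rw [Finset.mul_sum]
        exact Finset.sum_congr rfl fun i _ => by simp only [Pi.smul_apply, smul_eq_mul]; ring
      change -‖∑ i ∈ E, b i • y i‖ ≤ ∑ i ∈ E, b i * f (F.image φ) (φ i) ∧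
        ∑ i ∈ E, b i * f (F.image φ) (φ i) ≤ ‖∑ i ∈ E, b i • y i‖ at h2
      change |∑ i ∈ E, b i * ((1 + 8 * η)⁻¹ • g F) i| ≤ _
      rw [h3, abs_mul, abs_of_pos (inv_pos.2 hη1), inv_mul_le_iff₀ hη1]
      exact abs_le.2 ⟨by linarith, by linarith⟩
    · exact abs_sum_le_of_mem_dualBallValues (comp_mem_dualBallValues hlD φ) E b
    · exact abs_sum_le_of_mem_dualBallValues (comp_mem_dualBallValues (hhD _) φ) E b
  have hGnull : ∀ k ∈ G, Tendsto k atTop (𝓝 0) := by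
    have hnull : ∀ k ∈ dualBallValues x, Tendsto (k ∘ φ) atTop (𝓝 0) := fun k hk =>
      (tendsto_zero_of_mem_dualBallValues hx hk).comp hφ.tendsto_atTop
    rintro k (⟨_, ⟨F, hF, rfl⟩, rfl⟩ | rfl | ⟨i, rfl⟩)
    · have h1 : Tendsto (g F) atTop (𝓝 0) := by
        refine (hnull _ (hfD (F.image φ))).congr' ?_
        filter_upwards [eventually_ge_atTop (F.sup id)] with m hm
        have hFm : F.filter (· < m + 1) = F := Finset.filter_true_of_mem fun j hj =>
          Nat.lt_succ_of_le ((Finset.le_sup (f := id) hj).trans hm)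
        simp only [g, Function.comp_apply, hFm]
      have h2 := h1.const_smul (1 + 8 * η)⁻¹
      rw [smul_zero] at h2
      exact h2
    · exact hnull l hlD
    · exact hnull _ (hhD _)
  obtain ⟨α, z, hz, hzG, hGz⟩ := hGimage.exists_continuousMap.{u}
    (fun k hk j => by simpa [hy, hx.norm_eq_one] using hGsum k hk {j} 1)
    (fun j => ⟨h' j, Or.inr (Or.inr ⟨j, rfl⟩), hh1 _⟩) hGnull
  have hzapply : ∀ (E : Finset ℕ) (b : ℕ → ℝ) s, (∑ i ∈ E, b i • z i) s = ∑ i ∈ E, b i * z i s :=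
    fun E b s => by simp [ContinuousMap.sum_apply]
  have hznorm : ∀ (E : Finset ℕ) (b : ℕ → ℝ), ‖∑ i ∈ E, b i • z i‖ ≤ ‖∑ i ∈ E, b i • y i‖ := by
    intro E b
    refine (ContinuousMap.norm_le _ (norm_nonneg _)).2 fun s => ?_
    obtain ⟨k, hk, hks⟩ := hzG s
    rw [hzapply, Real.norm_eq_abs]
    simpa only [hks] using hGsum k hk E b
  refine ⟨α, z, hz, fun ψ hψ => ?_⟩
  -- A is an initial segment of the range of ψ, so its witness is supported on the subsequence; as A
  -- is in both the tree and S, `g A` approximates the functional chosen for this witness.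
  obtain ⟨n, A, hAT, hAS, hA⟩ := exists_mem_initialTree hS hup hφ
    (Set.infinite_range_of_injective hψ.injective)
  let φe : ℕ ↪ ℕ := ⟨φ, hφ.injective⟩
  let ψe : ℕ ↪ ℕ := ⟨ψ, hψ.injective⟩
  have hAφ : ((A.image φ : Finset ℕ) : Set ℕ) ⊆ Set.range φe := by
    rw [Finset.coe_image]
    exact Set.image_subset_range _ _
  obtain ⟨b, F, hb, hF⟩ := exists_eq_embDomain φe
    (fun i hi => hAφ (haA _ hAS hi)) (fun i hi => hAφ (hEA _ hAS hi))
  have hbA : b.support ⊆ A := by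
    have h1 := haA _ hAS
    rw [hb, Finsupp.support_embDomain] at h1
    intro i hi
    obtain ⟨j, hj, hji⟩ := Finset.mem_image.1 (h1 (Finset.mem_map_of_mem φe hi))
    exact hφ.injective hji ▸ hj
  have hFA : F ⊆ A := by
    have h1 := hEA _ hAS
    rw [hF] at h1
    intro i hi
    obtain ⟨j, hj, hji⟩ := Finset.mem_image.1 (h1 (Finset.mem_map_of_mem φe hi))
    exact hφ.injective hji ▸ hj
  have hnormy : ∑ i ∈ (a (A.image φ)).support, a (A.image φ) i • x i =
      ∑ i ∈ b.support, b i • y i := by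
    rw [hb, Finsupp.support_embDomain, Finset.sum_map]
    simp only [Finsupp.embDomain_apply_self]
    rfl
  have hQb := hcQ _ hAS
  have hVb := hcV _ hAS
  rw [hnormy] at hQb hVb
  rw [hb, hF, hQ.embDomain_iff] at hQb
  have hsumE : ∑ i ∈ E (A.image φ), a (A.image φ) i * c (A.image φ) i =
      ∑ i ∈ F, b i * f (A.image φ) (φ i) := by
    rw [hF, hb, Finset.sum_map, hfS _ hAS]
    simp only [Finsupp.embDomain_apply_self]
    rfl
  rw [hsumE] at hVb
  have hVz : Violates Q C z b F := by
    refine ⟨hQ.anti _ _ _ _ (hznorm _ _) hQb, ?_⟩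
    have hbcoeff : ∀ i ∈ F, |b i| ≤ 4 * ‖∑ i ∈ b.support, b i • y i‖ := by
      intro i _
      by_cases hi : i ∈ b.support
      · exact hcoeff _ _ hi
      · rw [Finsupp.notMem_support_iff.1 hi, abs_zero]
        positivity
    have h1 := abs_le.1 (hgsum A hAT F b _ hbcoeff (norm_nonneg _))
    obtain ⟨s, hs⟩ := hGz ((1 + 8 * η)⁻¹ • g A) (Or.inl ⟨_, ⟨A, hAT, rfl⟩, rfl⟩)
    have h2 : (1 + 8 * η) * (∑ i ∈ F, b i • z i) s = ∑ i ∈ F, b i * g A i := by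
      rw [hzapply, Finset.mul_sum]
      refine Finset.sum_congr rfl fun i _ => ?_
      rw [hs, Pi.smul_apply, smul_eq_mul]
      field_simp
    have h3 : (∑ i ∈ F, b i • z i) s ≤ ‖∑ i ∈ F, b i • z i‖ :=
      (le_abs_self _).trans ((∑ i ∈ F, b i • z i).norm_coe_le_norm s)
    have h4 := mul_le_mul_of_nonneg_left h3 hη1.le
    have h5 := mul_le_mul_of_nonneg_right hηC (norm_nonneg (∑ i ∈ b.support, b i • y i))
    -- With r the norm of the witness in y, the functional `g A` gives more than (C' - 8η) r, which
    -- is at least C (1 + 8η) r by the choice of η.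
    have h6 : (1 + 8 * η) * (C * ‖∑ i ∈ b.support, b i • y i‖) <
        (1 + 8 * η) * ‖∑ i ∈ F, b i • z i‖ := by linarith
    exact (mul_le_mul_of_nonneg_left (hznorm _ _) hC).trans_lt (lt_of_mul_lt_mul_left h6 hη1.le)
  have hAψ : (A : Set ℕ) ⊆ Set.range ψe := fun i hi => ((hA i).1 hi).1
  obtain ⟨b', F', rfl, rfl⟩ := exists_eq_embDomain ψe
    (fun i hi => hAψ (hbA hi)) (fun i hi => hAψ (hFA hi))
  exact ⟨b', F', (violates_embDomain_iff hQ ψe C z b' F').1 hVz⟩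

theorem supInfSubseq_seqConst_le {Q : (ℕ →₀ ℝ) → Finset ℕ → ℝ → Prop} (hQ : IsSideCondition Q) :
    supInfSubseq (X := X) (seqConst Q) ≤
      ⨆ α : CountableSuccOrdinal.{u}, supInfSubseq (X := C(α.Space, ℝ)) (seqConst Q) := by
  refine iSup₂_le fun x hx => ?_
  have hone : (1 : EReal) ≤ ⨅ (φ : ℕ → ℕ) (_ : StrictMono φ), seqConst Q (x ∘ φ) :=
    le_iInf₂ fun φ _ => one_le_seqConst hQ (hx.norm_eq_one _)
  refine le_of_not_gt fun hlt => ?_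
  -- The maximum with 0 makes C nonnegative; a second real number C' leaves the room lost in the
  -- perturbation.
  obtain ⟨C, hC, hCv⟩ := EReal.lt_iff_exists_real_btwn.1
    (max_lt hlt (zero_lt_one.trans_le hone))
  obtain ⟨C', hCC', hC'v⟩ := EReal.lt_iff_exists_real_btwn.1 hCv
  obtain ⟨α, z, hz, hzv⟩ := exists_continuousMap_violates hQ hx
    (EReal.coe_nonneg.1 ((le_max_right _ _).trans hC.le)) (EReal.coe_lt_coe_iff.1 hCC')
    fun φ hφ => exists_violates_of_lt (hC'v.trans_le (iInf₂_le φ hφ))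
  refine absurd ((le_max_left _ _).trans_lt hC) (not_lt.2 (le_iSup_of_le α ?_))
  refine le_iSup₂_of_le z hz (le_iInf₂ fun φ hφ => ?_)
  obtain ⟨a, E, h⟩ := hzv φ hφ
  exact le_seqConst_of_violates h

end Model

theorem iSup_supInfSubseq_eq {Q : (ℕ →₀ ℝ) → Finset ℕ → ℝ → Prop} (hQ : IsSideCondition Q) :
    (⨆ (X : Type u) (_ : NormedAddCommGroup X) (_ : NormedSpace ℝ X) (_ : CompleteSpace X),
      supInfSubseq (X := X) (seqConst Q)) =
      ⨆ α : CountableSuccOrdinal.{u}, supInfSubseq (X := C(α.Space, ℝ)) (seqConst Q) := by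
  refine le_antisymm ?_ (iSup_le fun α => ?_)
  · exact iSup_le fun X => iSup_le fun _ => iSup_le fun _ => iSup_le fun _ =>
      supInfSubseq_seqConst_le hQ
  · exact le_iSup_of_le C(α.Space, ℝ) (le_iSup_of_le inferInstance (le_iSup_of_le inferInstance
      (le_iSup_of_le inferInstance le_rfl)))

/-! ### The side conditions of the four constants. -/

section SideConditions

variable {δ : ℝ}

theorem forall_mem_map_le_abs_embDomain (φ : ℕ ↪ ℕ) (a : ℕ →₀ ℝ) (E : Finset ℕ) :
    (∀ i ∈ E.map φ, δ ≤ |a.embDomain φ i|) ↔ ∀ i ∈ E, δ ≤ |a i| := by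
  simp [Finsupp.embDomain_apply_self]

theorem forall_abs_embDomain_le_one (φ : ℕ ↪ ℕ) (a : ℕ →₀ ℝ) :
    (∀ i, |a.embDomain φ i| ≤ 1) ↔ ∀ i, |a i| ≤ 1 := by
  refine ⟨fun h i => by simpa [Finsupp.embDomain_apply_self] using h (φ i), fun h i => ?_⟩
  by_cases hi : i ∈ Set.range φ
  · obtain ⟨j, rfl⟩ := hi
    simpa [Finsupp.embDomain_apply_self] using h j
  · simp [Finsupp.embDomain_of_notMem_range _ _ _ hi]

theorem abs_single_le_one (i : ℕ) : |(Finsupp.single 0 1 : ℕ →₀ ℝ) i| ≤ 1 := by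
  rw [Finsupp.single_apply]
  split_ifs <;> simp

theorem isSideCondition_K (hδ : δ ≤ 1) :
    IsSideCondition fun a E _ => (∀ i ∈ E, δ ≤ |a i|) ∧ ∀ i, |a i| ≤ 1 where
  embDomain_iff φ a E _ := by
    rw [forall_mem_map_le_abs_embDomain, forall_abs_embDomain_le_one]
  anti _ _ _ _ _ h := h
  single _ _ := ⟨by simpa using hδ, abs_single_le_one⟩

theorem isSideCondition_KPrime (hδ : δ ≤ 1) :
    IsSideCondition fun a E r => (∀ i ∈ E, δ ≤ |a i|) ∧ r ≤ 1 where
  embDomain_iff φ a E _ := by rw [forall_mem_map_le_abs_embDomain]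
  anti _ _ _ _ hr h := ⟨h.1, hr.trans h.2⟩
  single _ hr := ⟨by simpa using hδ, hr⟩

theorem isSideCondition_L (hδ : δ ≤ 1) :
    IsSideCondition fun a _ _ => (∀ i ∈ a.support, δ ≤ |a i|) ∧ ∀ i, |a i| ≤ 1 where
  embDomain_iff φ a _ _ := by
    rw [Finsupp.support_embDomain, forall_mem_map_le_abs_embDomain, forall_abs_embDomain_le_one]
  anti _ _ _ _ _ h := h
  single _ _ := ⟨by simpa [Finsupp.support_single] using hδ, abs_single_le_one⟩

theorem isSideCondition_LPrime (hδ : δ ≤ 1) :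
    IsSideCondition fun a _ r => (∀ i ∈ a.support, δ ≤ |a i|) ∧ r ≤ 1 where
  embDomain_iff φ a _ _ := by
    rw [Finsupp.support_embDomain, forall_mem_map_le_abs_embDomain]
  anti _ _ _ _ hr h := ⟨h.1, hr.trans h.2⟩
  single _ hr := ⟨by simpa [Finsupp.support_single] using hδ, hr⟩

end SideConditions

section Specialize

variable {X : Type u} [NormedAddCommGroup X] [NormedSpace ℝ X] (δ : ℝ)

theorem seqConst_eq_seqK :
    seqConst (X := X) (fun a E _ => (∀ i ∈ E, δ ≤ |a i|) ∧ ∀ i, |a i| ≤ 1) =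
      seqK δ := by
  funext x
  simp only [seqConst, seqK, and_imp]

theorem seqConst_eq_seqKPrime :
    seqConst (X := X) (fun a E r => (∀ i ∈ E, δ ≤ |a i|) ∧ r ≤ 1) =
      seqKPrime δ := by
  funext x
  simp only [seqConst, seqKPrime, and_imp]

theorem seqConst_eq_seqL :
    seqConst (X := X) (fun a _ _ => (∀ i ∈ a.support, δ ≤ |a i|) ∧ ∀ i, |a i| ≤ 1) =
      seqL δ := by
  funext x
  simp only [seqConst, seqL, and_imp]

theorem seqConst_eq_seqLPrime :
    seqConst (X := X) (fun a _ r => (∀ i ∈ a.support, δ ≤ |a i|) ∧ r ≤ 1) =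
      seqLPrime δ := by
  funext x
  simp only [seqConst, seqLPrime, and_imp]

end Specialize

theorem theorem4 (δ : ℝ) (hδ : δ ∈ Set.Ioc (0 : ℝ) 1) :
    constK.{u} δ =
        (⨆ α : CountableSuccOrdinal.{u}, supInfSubseq (X := C(α.Space, ℝ)) (seqK δ)) ∧
    constKPrime.{u} δ =
        (⨆ α : CountableSuccOrdinal.{u}, supInfSubseq (X := C(α.Space, ℝ)) (seqKPrime δ)) ∧
    constL.{u} δ =
        (⨆ α : CountableSuccOrdinal.{u}, supInfSubseq (X := C(α.Space, ℝ)) (seqL δ)) ∧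
    constLPrime.{u} δ =
        (⨆ α : CountableSuccOrdinal.{u}, supInfSubseq (X := C(α.Space, ℝ)) (seqLPrime δ)) := by
  have h1 := iSup_supInfSubseq_eq.{u} (isSideCondition_K hδ.2)
  have h2 := iSup_supInfSubseq_eq.{u} (isSideCondition_KPrime hδ.2)
  have h3 := iSup_supInfSubseq_eq.{u} (isSideCondition_L hδ.2)
  have h4 := iSup_supInfSubseq_eq.{u} (isSideCondition_LPrime hδ.2)
  simp only [seqConst_eq_seqK] at h1
  simp only [seqConst_eq_seqKPrime] at h2
  simp only [seqConst_eq_seqL] at h3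
  simp only [seqConst_eq_seqLPrime] at h4
  exact ⟨h1, h2, h3, h4⟩
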